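/- Let $0<p<\infty$, let $u$ be a locally integrable function on $\mathbb R$ with $u>0$ a.e., and let $w\ge 0$ be a locally integrable function on $(0,\infty)$. Write $u(E)=\int_E u(x)\,dx$, $W(r)=\int_0^r w(s)\,ds$, and $|E|$ for Lebesgue measure. Let $f_u^*(t)=\inf\{s\ge 0: u(\{|f|>s\})\le t\}$, let $\Lambda^p_u(w)$ be the set of Lebesgue measurable functions $f$ on $\mathbb R$ with $\|f\|_{\Lambda^p_u(w)}=\left(\int_0^\infty f_u^*(t)^p\,w(t)\,dt\right)^{1/p}<\infty$, and put $$\|g\|_{(\Lambda^p_u(w))'}=\sup_{f\in\Lambda^p_u(w)}\frac{\left|\int_{\mathbb R} f(x)g(x)u(x)\,dx\right|}{\|f\|_{\Lambda^p_u(w)}},$$ where the numerator is $\infty$ if the integral does not converge absolutely. Quantities take values in $[0,\infty]$, with $0\cdot\infty=0/0=\infty/\infty=0$ and $a/0=\infty$ for $a>0$. Intervals $I\subset\mathbb R$ are bounded and have positive length, and $A\lesssim B$ means $A\le CB$ with a constant $C\in(0,\infty)$ that depends on $p,u,w$ only (not on $I$ or $E$). Consider the condition $$\|u^{-1}\chi_I\|_{(\Lambda^p_u(w))'}\,\|\chi_I\|_{\Lambda^p_u(w)}\lesssim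 |I|\quad\text{for every interval } I.\tag{d}$$ (i) If $p\le 1$, then (d) is equivalent to $$\frac{W(u(I))}{W(u(E))}\lesssim\left(\frac{|I|}{|E|}\right)^p\quad\text{for every interval } I \text{ and every measurable } E\subset I.\tag{b}$$ (ii) If $p>1$ and $p'=p/(p-1)$, then (d) is equivalent to $$\left(\int_0^{u(I)}\left(\frac{\phi_I(t)}{W(t)}\right)^{p'}w(t)\,dt\right)^{1/p'}\lesssim\frac{|I|}{W^{1/p}(u(I))}\quad\text{for every interval } I,$$ where $\phi_I(t)=\sup\{|E|: E\subset I \text{ measurable},\ u(E)=t\}$. -/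

import Mathlib

open MeasureTheory Set
open scoped ENNReal NNReal

noncomputable section

namespace WeightedLorentz

/-- `u(E) = ∫_E u(x) dx`. -/
def wMeas (u : ℝ → ℝ) (E : Set ℝ) : ℝ≥0∞ :=
  ∫⁻ x in E, ENNReal.ofReal (u x)

/-- The points `s` of the half line with `0 < s < r`, where `r ∈ [0, ∞]`. -/
def initialSegment (r : ℝ≥0∞) : Set ℝ :=
  {s : ℝ | 0 < s ∧ ENNReal.ofReal s < r}

/-- `W(r) = ∫_0^r w(s) ds`, for `r ∈ [0, ∞]`. -/
def primitive (w : ℝ → ℝ) (r : ℝ≥0∞) : ℝ≥0∞ :=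
  ∫⁻ s in initialSegment r, ENNReal.ofReal (w s)

/-- The decreasing rearrangement of `f` with respect to `u`:
`f*_u(t) = inf {s ≥ 0 : u({|f| > s}) ≤ t}`. -/
def rearrangement (u : ℝ → ℝ) (f : ℝ → ℝ) (t : ℝ) : ℝ≥0∞ :=
  sInf {s : ℝ≥0∞ | wMeas u {x | s < ENNReal.ofReal |f x|} ≤ ENNReal.ofReal t}

/-- The quasi-norm `(∫_0^∞ f*_u(t)^p w(t) dt)^{1/p}` of `Λ^p_u(w)`. -/
def lorentzNorm (p : ℝ) (u w : ℝ → ℝ) (f : ℝ → ℝ) : ℝ≥0∞ :=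
  (∫⁻ t in Ioi (0 : ℝ), rearrangement u f t ^ p * ENNReal.ofReal (w t)) ^ (1 / p)

/-- The space `Λ^p_u(w)` of Lebesgue measurable functions with finite quasi-norm. -/
def lorentzSpace (p : ℝ) (u w : ℝ → ℝ) : Set (ℝ → ℝ) :=
  {f | AEMeasurable f volume ∧ lorentzNorm p u w f < ∞}

open Classical in
/-- `|∫ f g u dx|`, with the value `∞` if the integral does not converge absolutely. -/
def absPairing (u : ℝ → ℝ) (f g : ℝ → ℝ) : ℝ≥0∞ :=
  if Integrable (fun x => f x * g x * u x) volume then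
    ENNReal.ofReal |∫ x, f x * g x * u x|
  else ∞

/-- The norm of the associate space of `Λ^p_u(w)`:
the supremum of `|∫ f g u dx| / ‖f‖` over `f ∈ Λ^p_u(w)` (where `0 / 0 = 0`, `a / 0 = ∞`). -/
def associateNorm (p : ℝ) (u w : ℝ → ℝ) (g : ℝ → ℝ) : ℝ≥0∞ :=
  ⨆ f ∈ lorentzSpace p u w, absPairing u f g / lorentzNorm p u w f

/-- Bounded nondegenerate intervals of the real line, of any type (open, closed, half-open). -/
def IsInterval (I : Set ℝ) : Prop :=
  I.OrdConnected ∧ Bornology.IsBounded I ∧ I.Nontrivial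

/-- `W(u(I)) / W(u(E)) ≲ (|I| / |E|)^p` for all intervals `I` and measurable `E ⊆ I`. -/
def QuasiconcaveCondition (p : ℝ) (u w : ℝ → ℝ) : Prop :=
  ∃ C : ℝ≥0, 0 < C ∧ ∀ I : Set ℝ, IsInterval I →
    ∀ E : Set ℝ, NullMeasurableSet E volume → E ⊆ I →
      primitive w (wMeas u I) / primitive w (wMeas u E) ≤ C * (volume I / volume E) ^ p

/-- `‖u⁻¹ χ_I‖_{(Λ^p_u(w))'} ‖χ_I‖_{Λ^p_u(w)} ≲ |I|` for all intervals `I`. -/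
def DualityCondition (p : ℝ) (u w : ℝ → ℝ) : Prop :=
  ∃ C : ℝ≥0, 0 < C ∧ ∀ I : Set ℝ, IsInterval I →
    associateNorm p u w (I.indicator fun x => (u x)⁻¹) *
      lorentzNorm p u w (I.indicator fun _ => 1) ≤ C * volume I

/-- `φ_I(t) = sup {|E| : E ⊆ I, u(E) = t}`. -/
def phi (u : ℝ → ℝ) (I : Set ℝ) (t : ℝ) : ℝ≥0∞ :=
  sSup {m : ℝ≥0∞ | ∃ E : Set ℝ, NullMeasurableSet E volume ∧ E ⊆ I ∧
    wMeas u E = ENNReal.ofReal t ∧ volume E = m}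

/-- `(∫_0^{u(I)} (φ_I(t) / W(t))^{p'} w(t) dt)^{1/p'} ≲ |I| / W(u(I))^{1/p}` for all
intervals `I`, where `p' = p / (p - 1)`. -/
def HardyCondition (p : ℝ) (u w : ℝ → ℝ) : Prop :=
  ∃ C : ℝ≥0, 0 < C ∧ ∀ I : Set ℝ, IsInterval I →
    (∫⁻ t in initialSegment (wMeas u I),
      (phi u I t / primitive w (ENNReal.ofReal t)) ^ (p / (p - 1)) *
        ENNReal.ofReal (w t)) ^ (1 / (p / (p - 1))) ≤
      C * (volume I / primitive w (wMeas u I) ^ (1 / p))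

end WeightedLorentz

end

open Filter
open scoped Topology

noncomputable section

namespace WeightedLorentz

/-! Since `f · u⁻¹χ_I · u = f χ_I` almost everywhere and `‖χ_I‖ = W(u(I))^{1/p}`, condition (d) says
that `(∫_I |f|) W(u(I))^{1/p} ≲ |I| ‖f‖` for all `f` in the space. Everything is read off the dyadic
level sets `D_j = {|f| > 2^j}` and `E_j = D_j ∩ I`: on one side `∫_I |f| ≤ 2 ∑ 2^j |E_j|`, on the
other `∑ 2^{jp} W(u(D_j)) ≲ ‖f‖^p` (`setLIntegral_le_tsum`, `tsum_two_rpow_mul_primitive_le`).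

For `p ≤ 1`, (b) is (d) tested on `χ_E`. Conversely, the `p`-th power is subadditive, so (b) can be
applied to each `E_j` separately and summed.

For `p > 1`, sufficiency rests on `|E| ≤ 2 ∫ φ_I/W dw` over `{W ≤ 2W(u(E))}`, valid when `2W(u(E)) ≤
W(u(I))` (`volume_le_of_hardy`). Summing over the levels and applying Hölder leaves the `L^p(w)`
norm of a sum of powers of 2, which is comparable with its largest term. On the other levels `|E_j|
≤ |I|` is enough.

For necessity, take `t_k` with `W(t_k) = 2^{-k} W(u(I))`, nested sets `E_k` attaining `φ_I(t_k)`,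
and test on `∑ r_k^{p'-1} χ_{E_k}` with `r_k = φ_I(t_k)/W(t_k)`. A discrete Hardy inequality bounds
its norm (`lorentzNorm_stepFun_rpow_le`), and the Hardy integral is at most a constant times `∑
r_k^{p'} W(t_k)`. The nested extremal sets come from the bathtub principle: fill `I` in increasing
order of `u`, breaking ties by position (`exists_extremal_family`). -/

/-! ### Dyadic sums -/

/-- The sum of the geometric series of ratio `2 ^ (-q)`. -/
def geomConst (q : ℝ) : ℝ≥0∞ := ∑' n : ℕ, ((2 : ℝ≥0∞) ^ (-q)) ^ n

theorem geomConst_ne_top {q : ℝ} (hq : 0 < q) : geomConst q ≠ ∞ := by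
  rw [geomConst, ENNReal.tsum_geometric]
  refine ENNReal.inv_ne_top.2 (tsub_pos_of_lt ?_).ne'
  exact ENNReal.rpow_lt_one_of_one_lt_of_neg (by norm_num) (by linarith)

theorem one_le_geomConst (q : ℝ) : 1 ≤ geomConst q := by
  simpa only [geomConst, pow_zero] using
    ENNReal.le_tsum (f := fun n : ℕ => ((2 : ℝ≥0∞) ^ (-q)) ^ n) 0

theorem two_rpow_pos (x : ℝ) : 0 < (2 : ℝ≥0∞) ^ x := ENNReal.rpow_pos (by norm_num) (by norm_num)

theorem two_rpow_ne_top (x : ℝ) : (2 : ℝ≥0∞) ^ x ≠ ∞ :=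
  ENNReal.rpow_ne_top_of_ne_zero (by norm_num) (by norm_num)

theorem two_rpow_add (x y : ℝ) : (2 : ℝ≥0∞) ^ (x + y) = 2 ^ x * 2 ^ y :=
  ENNReal.rpow_add _ _ (by norm_num) (by norm_num)

theorem two_rpow_mono {x y : ℝ} (h : x ≤ y) : (2 : ℝ≥0∞) ^ x ≤ 2 ^ y :=
  ENNReal.rpow_le_rpow_of_exponent_le (by norm_num) h

theorem tsum_indicator_two_rpow_le (q : ℝ) {S : Set ℤ} {J : ℤ} (hS : ∀ j ∈ S, j ≤ J) :
    ∑' j : ℤ, S.indicator (fun j : ℤ => (2 : ℝ≥0∞) ^ ((j : ℝ) * q)) j ≤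
      geomConst q * 2 ^ ((J : ℝ) * q) := by
  rw [← (Equiv.subLeft J).tsum_eq, mul_comm, geomConst, ← ENNReal.tsum_mul_left,
    ← Function.Injective.tsum_eq (Nat.cast_injective (R := ℤ))]
  · refine ENNReal.tsum_le_tsum fun n => ?_
    refine (indicator_le_self _ _ _).trans ?_
    rw [← ENNReal.rpow_natCast, ← ENNReal.rpow_mul, ← two_rpow_add]
    refine le_of_eq ?_
    congr 1
    simp [Equiv.subLeft]
    ring
  · intro j hj
    have : J - j ∈ S := by
      by_contra h
      simp [h] at hj
    exact ⟨j.toNat, Int.toNat_of_nonneg (by have := hS _ this; omega)⟩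

theorem tsum_two_rpow_le_rpow {p : ℝ} (hp : 0 < p) (y : ℝ≥0∞) :
    ∑' j : ℤ, {j : ℤ | (2 : ℝ≥0∞) ^ (j : ℝ) ≤ y}.indicator
      (fun j : ℤ => (2 : ℝ≥0∞) ^ ((j : ℝ) * p)) j ≤ geomConst p * y ^ p := by
  rcases eq_or_ne y ∞ with rfl | hy
  · rw [ENNReal.top_rpow_of_pos hp, ENNReal.mul_top]
    · exact le_top
    · exact (zero_lt_one.trans_le (one_le_geomConst p)).ne'
  rcases eq_or_ne y 0 with rfl | hy0
  · have : {j : ℤ | (2 : ℝ≥0∞) ^ (j : ℝ) ≤ 0} = ∅ := by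
      ext j; simpa using (two_rpow_pos j).ne'
    simp only [this, indicator_empty, tsum_zero]
    exact zero_le
  · obtain ⟨J, hJ1, hJ2⟩ := ENNReal.exists_mem_Ico_zpow (y := 2) hy0 hy (by norm_num) (by norm_num)
    rw [← ENNReal.rpow_intCast] at hJ1 hJ2
    refine (tsum_indicator_two_rpow_le p (J := J) ?_).trans ?_
    · intro j hj
      by_contra h
      have h1 : (2 : ℝ≥0∞) ^ ((J + 1 : ℤ) : ℝ) ≤ 2 ^ (j : ℝ) :=
        two_rpow_mono (by exact_mod_cast (not_le.1 h))
      exact absurd (h1.trans hj) (not_le.2 hJ2)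
    · rw [ENNReal.rpow_mul]
      gcongr

/-- A sum of distinct powers of 2 is comparable with its largest term, so a power can be moved
inside for every `p > 0`. If `S` is unbounded above, the right side is infinite. -/
theorem tsum_indicator_two_rpow_rpow_le {p : ℝ} (hp : 0 < p) (S : Set ℤ) :
    (∑' j : ℤ, S.indicator (fun j : ℤ => (2 : ℝ≥0∞) ^ (j : ℝ)) j) ^ p ≤
      geomConst 1 ^ p * ∑' j : ℤ, S.indicator (fun j : ℤ => (2 : ℝ≥0∞) ^ ((j : ℝ) * p)) j := by
  have hle : ∀ j ∈ S, (2 : ℝ≥0∞) ^ ((j : ℝ) * p) ≤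
      ∑' j : ℤ, S.indicator (fun j : ℤ => (2 : ℝ≥0∞) ^ ((j : ℝ) * p)) j := fun j hj => by
    have := ENNReal.le_tsum (f := S.indicator fun j : ℤ => (2 : ℝ≥0∞) ^ ((j : ℝ) * p)) j
    rwa [indicator_of_mem hj] at this
  by_cases hb : ∃ b : ℤ, ∀ j ∈ S, j ≤ b
  · rcases S.eq_empty_or_nonempty with rfl | hne
    · simp [hp]
    · obtain ⟨J, hJ, hmax⟩ := Int.exists_greatest_of_bdd (P := (· ∈ S)) hb hne
      have := tsum_indicator_two_rpow_le 1 hmax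
      simp only [mul_one] at this
      calc _ ≤ (geomConst 1 * 2 ^ (J : ℝ)) ^ p := by gcongr
        _ = geomConst 1 ^ p * 2 ^ ((J : ℝ) * p) := by
          rw [ENNReal.mul_rpow_of_nonneg _ _ hp.le, ENNReal.rpow_mul]
        _ ≤ _ := by gcongr; exact hle J hJ
  · push Not at hb
    have : ∑' j : ℤ, S.indicator (fun j : ℤ => (2 : ℝ≥0∞) ^ ((j : ℝ) * p)) j = ∞ := by
      refine ENNReal.eq_top_of_forall_nnreal_le fun r => ?_
      obtain ⟨n, hn⟩ := pow_unbounded_of_one_lt (r : ℝ) (Real.one_lt_rpow (x := 2) (by norm_num) hp)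
      obtain ⟨j, hj, hnj⟩ := hb n
      refine le_trans ?_ (hle j hj)
      refine le_trans ?_ (two_rpow_mono (x := (n : ℝ) * p) ?_)
      · rw [mul_comm, ENNReal.rpow_mul, ENNReal.rpow_natCast]
        have : ((2 : ℝ≥0) ^ p) ^ n ≥ r := by
          rw [ge_iff_le, ← NNReal.coe_le_coe]; push_cast; exact hn.le
        have h2 : ((2 : ℝ≥0∞) ^ p) = ((2 : ℝ≥0) ^ p : ℝ≥0) := by
          rw [ENNReal.coe_rpow_of_nonneg _ hp.le]; rfl
        rw [h2]; exact_mod_cast this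
      · gcongr; exact_mod_cast hnj.le
    rw [this, ENNReal.mul_top]
    · exact le_top
    · exact (ENNReal.rpow_pos (zero_lt_one.trans_le (one_le_geomConst 1))
        (geomConst_ne_top one_pos)).ne'

theorem tsum_rpow_le {ι : Type*} {p : ℝ} (hp : 0 < p) (hp1 : p ≤ 1) (a : ι → ℝ≥0∞) :
    (∑' i, a i) ^ p ≤ ∑' i, a i ^ p := by
  have hfin : ∀ s : Finset ι, (∑ i ∈ s, a i) ^ p ≤ ∑ i ∈ s, a i ^ p := fun s => by
    classical
    induction s using Finset.induction_on with
    | empty => simp [hp]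
    | insert i s hi ih =>
      rw [Finset.sum_insert hi, Finset.sum_insert hi]
      exact (ENNReal.rpow_add_le_add_rpow _ _ hp.le hp1).trans (by gcongr)
  rw [← ENNReal.le_rpow_inv_iff hp, ENNReal.tsum_eq_iSup_sum]
  refine iSup_le fun s => ?_
  rw [ENNReal.le_rpow_inv_iff hp]
  exact (hfin s).trans (ENNReal.sum_le_tsum s)

theorem le_tsum_two_rpow {y : ℝ≥0∞} (hy : y ≠ ∞) :
    y ≤ ∑' j : ℤ, 2 * {j : ℤ | (2 : ℝ≥0∞) ^ (j : ℝ) < y}.indicator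
      (fun j : ℤ => (2 : ℝ≥0∞) ^ (j : ℝ)) j := by
  rcases eq_or_ne y 0 with rfl | hy0
  · exact zero_le
  · obtain ⟨J, hJ1, hJ2⟩ := ENNReal.exists_mem_Ioc_zpow (y := 2) hy0 hy (by norm_num) (by norm_num)
    rw [← ENNReal.rpow_intCast] at hJ1 hJ2
    refine le_trans ?_ (ENNReal.le_tsum J)
    rw [indicator_of_mem (by exact hJ1)]
    refine hJ2.trans_eq ?_
    push_cast
    rw [two_rpow_add, ENNReal.rpow_one, mul_comm]

/-! ### Sets of prescribed measure -/

/-- Dominated convergence: as points are null, `z ↦ χ_{y < z}` is continuous at `x` for almost every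
`y`. -/
theorem continuous_measure_Iio (m : Measure ℝ) [IsFiniteMeasure m] [NullSingletonClass m] :
    Continuous fun x => m (Iio x) := by
  have h : Continuous fun x => (m (Iio x)).toReal := by
    have heq : (fun x => (m (Iio x)).toReal) =
        fun x => ∫ y, (Iio x).indicator (fun _ => (1 : ℝ)) y ∂m := by
      funext x
      rw [integral_indicator measurableSet_Iio]
      simp [Measure.real]
    rw [heq, continuous_iff_continuousAt]
    intro x
    refine continuousAt_of_dominated (bound := fun _ => 1) ?_ ?_ (integrable_const _) ?_
    · exact Eventually.of_forall fun z =>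
        (measurable_const.indicator measurableSet_Iio).aestronglyMeasurable
    · refine Eventually.of_forall fun z => Eventually.of_forall fun y => ?_
      by_cases hy : y ∈ Iio z <;> simp [hy]
    · have : ∀ᵐ y ∂m, y ≠ x := by simp [ae_iff]
      filter_upwards [this] with y hy
      rcases lt_or_gt_of_ne hy with hlt | hlt
      · refine (continuousAt_const (y := (1 : ℝ))).congr ?_
        filter_upwards [lt_mem_nhds hlt] with z hz
        simp [hz]
      · refine (continuousAt_const (y := (0 : ℝ))).congr ?_
        filter_upwards [gt_mem_nhds hlt] with z hz
        simp [hz.le]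
  have h2 := ENNReal.continuous_ofReal.comp h
  refine h2.congr fun x => ?_
  simp

/-- The intermediate value theorem. It serves to cut the tie set of `u` and to solve `W(s) = c`. -/
theorem exists_measure_inter_Iio_eq {m : Measure ℝ} [NullSingletonClass m] {S : Set ℝ}
    (hS : Bornology.IsBounded S) (hfin : m S ≠ ∞) {c : ℝ≥0∞} (hc : c ≤ m S) :
    ∃ x, m (S ∩ Iio x) = c := by
  have : IsFiniteMeasure (m.restrict S) := ⟨by simpa using hfin.lt_top⟩
  obtain ⟨R, hR⟩ := hS.subset_closedBall 0
  rw [Real.closedBall_eq_Icc] at hR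
  have key : ∀ x, (m.restrict S) (Iio x) = m (S ∩ Iio x) := fun x => by
    rw [Measure.restrict_apply measurableSet_Iio, inter_comm]
  have h0 : (m.restrict S) (Iio (0 - R)) = 0 := by
    rw [key, show S ∩ Iio (0 - R) = ∅ from ?_, measure_empty]
    ext y
    simp only [mem_inter_iff, mem_Iio, mem_empty_iff_false, iff_false, not_and, not_lt]
    exact fun hy => (hR hy).1
  have h1 : (m.restrict S) (Iio (0 + R + 1)) = m S := by
    rw [key, inter_eq_left.2]
    exact fun y hy => (hR hy).2.trans_lt (lt_add_one _)
  obtain ⟨x, hx⟩ := mem_range_of_exists_le_of_exists_ge (continuous_measure_Iio (m.restrict S))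
    ⟨0 - R, h0.trans_le zero_le⟩ ⟨0 + R + 1, hc.trans_eq h1.symm⟩
  exact ⟨x, (key x).symm.trans hx⟩

/-- The measure with density `u` with respect to Lebesgue measure. -/
def weight (u : ℝ → ℝ) : Measure ℝ := volume.withDensity fun x => ENNReal.ofReal (u x)

theorem wMeas_eq (u : ℝ → ℝ) (E : Set ℝ) : wMeas u E = weight u E :=
  (withDensity_apply' _ _).symm

instance (u : ℝ → ℝ) : NullSingletonClass (weight u) := by unfold weight; infer_instance

theorem weight_absolutelyContinuous (u : ℝ → ℝ) : weight u ≪ volume :=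
  withDensity_absolutelyContinuous _ _

theorem absolutelyContinuous_weight {u : ℝ → ℝ} (hu : LocallyIntegrable u volume)
    (hu_pos : ∀ᵐ x ∂volume, 0 < u x) : volume ≪ weight u :=
  withDensity_absolutelyContinuous' hu.aestronglyMeasurable.aemeasurable.ennreal_ofReal
    (hu_pos.mono fun x hx => by simpa using hx)

theorem weight_ne_top {u : ℝ → ℝ} (hu : LocallyIntegrable u volume) {E : Set ℝ}
    (hE : Bornology.IsBounded E) : weight u E ≠ ∞ := by
  obtain ⟨R, hR⟩ := hE.subset_closedBall 0
  have h := (hu.integrableOn_isCompact (isCompact_closedBall (0 : ℝ) R)).2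
  rw [← wMeas_eq, wMeas]
  refine ((lintegral_mono_set hR).trans (lintegral_mono fun x => ?_)).trans_lt h |>.ne
  exact Real.ofReal_le_enorm _

theorem IsInterval.volume_ne_top {I : Set ℝ} (hI : IsInterval I) : volume I ≠ ∞ :=
  hI.2.1.measure_lt_top.ne

theorem IsInterval.measurableSet {I : Set ℝ} (hI : IsInterval I) : MeasurableSet I :=
  hI.1.measurableSet

theorem IsInterval.volume_pos {I : Set ℝ} (hI : IsInterval I) : 0 < volume I := by
  obtain ⟨x, hx, y, hy, hxy⟩ := hI.2.2.exists_lt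
  refine lt_of_lt_of_le ?_ (measure_mono (hI.1.out hx hy))
  simpa using hxy

theorem volume_mul_le_weight {u : ℝ → ℝ} {A : Set ℝ} (hA : NullMeasurableSet A volume) {l : ℝ}
    (h : ∀ x ∈ A, l ≤ u x) : ENNReal.ofReal l * volume A ≤ weight u A := by
  rw [← wMeas_eq, wMeas]
  calc ENNReal.ofReal l * volume A = ∫⁻ _ in A, ENNReal.ofReal l := by simp
    _ ≤ _ := by
      exact lintegral_mono_ae ((ae_restrict_mem₀ hA).mono fun x hx =>
        ENNReal.ofReal_le_ofReal (h x hx))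

theorem weight_le_mul_volume {u : ℝ → ℝ} {A : Set ℝ} (hA : NullMeasurableSet A volume) {l : ℝ}
    (h : ∀ x ∈ A, u x ≤ l) : weight u A ≤ ENNReal.ofReal l * volume A := by
  rw [← wMeas_eq, wMeas]
  calc _ ≤ ∫⁻ _ in A, ENNReal.ofReal l := by
        exact lintegral_mono_ae ((ae_restrict_mem₀ hA).mono fun x hx =>
        ENNReal.ofReal_le_ofReal (h x hx))
    _ = ENNReal.ofReal l * volume A := by simp

/-- The initial segments of `I` for the order that compares first the values of `u`. -/
def lexSegment (u : ℝ → ℝ) (I : Set ℝ) (a : ℝ ×ₗ ℝ) : Set ℝ := {y | y ∈ I ∧ toLex (u y, y) < a}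

theorem lexSegment_mono (u : ℝ → ℝ) (I : Set ℝ) : Monotone (lexSegment u I) :=
  fun _ _ hab _ hy => ⟨hy.1, hy.2.trans_le hab⟩

theorem lexSegment_eq (u : ℝ → ℝ) (I : Set ℝ) (l x : ℝ) :
    lexSegment u I (toLex (l, x)) = (I ∩ {y | u y < l}) ∪ ((I ∩ {y | u y = l}) ∩ Iio x) := by
  ext y
  simp only [lexSegment, Prod.Lex.toLex_lt_toLex, mem_ofPred_eq, mem_union, mem_inter_iff, mem_Iio]
  tauto

theorem nullMeasurableSet_lexSegment {u : ℝ → ℝ} (hu : AEMeasurable u volume) {I : Set ℝ}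
    (hI : MeasurableSet I) (l x : ℝ) :
    NullMeasurableSet (lexSegment u I (toLex (l, x))) volume := by
  rw [lexSegment_eq]
  have h1 : NullMeasurableSet {y | u y < l} volume := nullMeasurableSet_lt hu aemeasurable_const
  have h2 : NullMeasurableSet {y | u y = l} volume := nullMeasurableSet_eq_fun hu aemeasurable_const
  exact (hI.nullMeasurableSet.inter h1).union
    ((hI.nullMeasurableSet.inter h2).inter measurableSet_Iio.nullMeasurableSet)

/-- With `l` the infimum of the levels where `{u ≤ l}` has weight above `t`, continuity of the
measure gives `u({u < l}) ≤ t ≤ u({u ≤ l})` inside `I`. The deficit is cut from `{u = l}` by a half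
line. -/
theorem exists_lexSegment {u : ℝ → ℝ} (hu : LocallyIntegrable u volume)
    (hu_pos : ∀ᵐ x ∂volume, 0 < u x) {I : Set ℝ} (hI : IsInterval I) {t : ℝ≥0∞} (ht0 : 0 < t)
    (ht : t < weight u I) :
    ∃ l x : ℝ, 0 < l ∧ weight u (lexSegment u I (toLex (l, x))) = t := by
  have hum := hu.aestronglyMeasurable.aemeasurable
  have hIfin := weight_ne_top hu hI.2.1
  have hnm : ∀ {s : Set ℝ}, NullMeasurableSet s volume → NullMeasurableSet s (weight u) :=
    fun h => h.mono_ac (weight_absolutelyContinuous u)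
  have hle : ∀ l : ℝ, NullMeasurableSet (I ∩ {y | u y ≤ l}) (weight u) := fun l =>
    hnm (hI.measurableSet.nullMeasurableSet.inter (nullMeasurableSet_le hum aemeasurable_const))
  set T : Set ℝ := {l | t < weight u (I ∩ {y | u y ≤ l})} with hT
  have hTne : T.Nonempty := by
    have hlim : Tendsto (fun n : ℕ => weight u (I ∩ {y | u y ≤ n})) atTop (𝓝 (weight u I)) := by
      have := tendsto_measure_iUnion_atTop (μ := weight u) (s := fun n : ℕ => I ∩ {y | u y ≤ n})
        (fun a b hab y hy => ⟨hy.1, show u y ≤ (b : ℝ) from le_trans hy.2 (Nat.cast_le.2 hab)⟩)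
      rwa [← inter_iUnion, inter_eq_left.2] at this
      intro y _
      obtain ⟨n, hn⟩ := exists_nat_ge (u y)
      exact mem_iUnion.2 ⟨n, hn⟩
    obtain ⟨n, hn⟩ := (hlim.eventually (lt_mem_nhds ht)).exists
    exact ⟨n, hn⟩
  have hpos : ∀ l : ℝ, l ≤ 0 → weight u (I ∩ {y | u y ≤ l}) = 0 := fun l hl => by
    refine measure_mono_null (fun y hy => ?_) (weight_absolutelyContinuous u (ae_iff.1 hu_pos))
    exact not_lt.2 (hy.2.trans hl)
  have hTbdd : BddBelow T := ⟨0, fun l hl => by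
    by_contra h
    have := hpos l (not_le.1 h).le
    simp only [hT, mem_ofPred_eq, this] at hl
    exact absurd hl (by simp)⟩
  set l := sInf T with hl
  have hgt : ∀ r, l < r → t < weight u (I ∩ {y | u y ≤ r}) := fun r hr => by
    obtain ⟨r', hr', hlt⟩ := exists_lt_of_csInf_lt hTne hr
    exact lt_of_lt_of_le hr' (measure_mono fun y hy => ⟨hy.1, hy.2.trans hlt.le⟩)
  have hge : t ≤ weight u (I ∩ {y | u y ≤ l}) := by
    have h := tendsto_measure_iInter_atTop (μ := weight u)
      (s := fun n : ℕ => I ∩ {y | u y ≤ l + 1 / ((n : ℝ) + 1)}) (fun n => hle _)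
      (fun a b hab y hy => ⟨hy.1, le_trans hy.2
        (add_le_add_right (one_div_le_one_div_of_le (by positivity)
          (by exact_mod_cast Nat.succ_le_succ hab)) l)⟩)
      ⟨0, measure_ne_top_of_subset inter_subset_left hIfin⟩
    have heq : ⋂ n : ℕ, I ∩ {y | u y ≤ l + 1 / ((n : ℝ) + 1)} = I ∩ {y | u y ≤ l} := by
      rw [← inter_iInter]
      congr 1
      ext y
      simp only [mem_iInter, mem_ofPred_eq]
      constructor
      · intro h
        have : Tendsto (fun n : ℕ => l + 1 / ((n : ℝ) + 1)) atTop (𝓝 (l + 0)) :=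
          tendsto_const_nhds.add tendsto_one_div_add_atTop_nhds_zero_nat
        rw [add_zero] at this
        exact ge_of_tendsto' this h
      · intro h n
        have : 0 < 1 / ((n : ℝ) + 1) := by positivity
        linarith
    rw [heq] at h
    exact ge_of_tendsto' h fun n => (hgt _ (by
      have : 0 < 1 / ((n : ℝ) + 1) := by positivity
      linarith)).le
  have hlt : weight u (I ∩ {y | u y < l}) ≤ t := by
    have h := tendsto_measure_iUnion_atTop (μ := weight u)
      (s := fun n : ℕ => I ∩ {y | u y ≤ l - 1 / ((n : ℝ) + 1)})
      (fun a b hab y hy => ⟨hy.1, le_trans hy.2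
        (sub_le_sub_left (one_div_le_one_div_of_le (by positivity)
          (by exact_mod_cast Nat.succ_le_succ hab)) l)⟩)
    have heq : ⋃ n : ℕ, I ∩ {y | u y ≤ l - 1 / ((n : ℝ) + 1)} = I ∩ {y | u y < l} := by
      rw [← inter_iUnion]
      congr 1
      ext y
      simp only [mem_iUnion, mem_ofPred_eq]
      constructor
      · rintro ⟨n, hn⟩
        have : 0 < 1 / ((n : ℝ) + 1) := by positivity
        linarith
      · intro h
        obtain ⟨n, hn⟩ := exists_nat_one_div_lt (sub_pos.2 h)
        exact ⟨n, by linarith⟩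
    rw [heq] at h
    refine le_of_tendsto' h fun n => not_lt.1 fun hn => ?_
    have h1 : l ≤ l - 1 / ((n : ℝ) + 1) := csInf_le hTbdd hn
    have : 0 < 1 / ((n : ℝ) + 1) := by positivity
    linarith
  have hl0 : 0 < l := by
    by_contra h
    have := hpos l (not_lt.1 h)
    exact absurd (hge.trans_eq this) (not_le.2 ht0)
  have hm1 : NullMeasurableSet (I ∩ {y | u y < l}) (weight u) :=
    hnm (hI.measurableSet.nullMeasurableSet.inter (nullMeasurableSet_lt hum aemeasurable_const))
  have hsplit : weight u (I ∩ {y | u y ≤ l}) ≤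
      weight u (I ∩ {y | u y < l}) + weight u (I ∩ {y | u y = l}) := by
    refine (measure_mono fun y hy => ?_).trans (measure_union_le _ _)
    rcases lt_or_eq_of_le (show u y ≤ l from hy.2) with h | h
    · exact Or.inl ⟨hy.1, h⟩
    · exact Or.inr ⟨hy.1, h⟩
  obtain ⟨x, hx⟩ := exists_measure_inter_Iio_eq (m := weight u) (S := I ∩ {y | u y = l})
    (hI.2.1.subset inter_subset_left) (measure_ne_top_of_subset inter_subset_left hIfin)
    (c := t - weight u (I ∩ {y | u y < l})) (tsub_le_iff_left.2 (hge.trans hsplit))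
  refine ⟨l, x, hl0, ?_⟩
  rw [lexSegment_eq, measure_union₀' hm1, hx, add_tsub_cancel_of_le hlt]
  refine Disjoint.aedisjoint (disjoint_left.2 fun y hy hy' => ?_)
  exact absurd hy'.1.2 (ne_of_lt hy.2)

/-- The bathtub principle. With `E` the segment, `u ≥ l` on `F \ E`, `u ≤ l` on `E \ F`, and these
differences have equal weight, so `l |F \ E| ≤ l |E \ F|`. -/
theorem volume_le_of_lexSegment {u : ℝ → ℝ} (hu : LocallyIntegrable u volume) {I : Set ℝ}
    (hI : IsInterval I) {l x : ℝ} (hl : 0 < l) {F : Set ℝ} (hF : NullMeasurableSet F volume)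
    (hFI : F ⊆ I) (h : weight u F = weight u (lexSegment u I (toLex (l, x)))) :
    volume F ≤ volume (lexSegment u I (toLex (l, x))) := by
  have hum := hu.aestronglyMeasurable.aemeasurable
  set E := lexSegment u I (toLex (l, x)) with hE
  have hEm : NullMeasurableSet E volume := nullMeasurableSet_lexSegment hum hI.measurableSet l x
  have hEI : E ⊆ I := fun y hy => hy.1
  have hac := weight_absolutelyContinuous u
  have h1 : weight u (F \ E) = weight u (E \ F) := by
    have a := measure_inter_add_sdiff₀ (μ := weight u) F (hEm.mono_ac hac)
    have b := measure_inter_add_sdiff₀ (μ := weight u) E (hF.mono_ac hac)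
    rw [inter_comm] at b
    have hfin : weight u (F ∩ E) ≠ ∞ :=
      measure_ne_top_of_subset (inter_subset_left.trans hFI) (weight_ne_top hu hI.2.1)
    rw [← b, ← a] at h
    exact (ENNReal.add_right_inj hfin).1 h
  have h2 : volume (F \ E) ≤ volume (E \ F) := by
    have a := volume_mul_le_weight (u := u) (hF.diff hEm) (l := l) fun y hy => by
      by_contra hlt
      exact hy.2 (hE ▸ lexSegment_eq u I l x ▸ Or.inl ⟨hFI hy.1, not_le.1 hlt⟩)
    have b := weight_le_mul_volume (u := u) (hEm.diff hF) (l := l) fun y hy => by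
      have := hy.1
      rw [hE, lexSegment_eq] at this
      rcases this with h | h
      · exact le_of_lt h.2
      · exact le_of_eq h.1.2
    have := (a.trans_eq h1).trans b
    exact (ENNReal.mul_le_mul_iff_right (by simpa using hl) ENNReal.ofReal_ne_top).1 this
  rw [← measure_inter_add_sdiff₀ F hEm, ← measure_inter_add_sdiff₀ E hF, inter_comm E F]
  gcongr

/-- For every interval `I` the suprema defining `φ_I` are attained on an increasing family. -/
theorem exists_extremal_family {u : ℝ → ℝ} (hu : LocallyIntegrable u volume)
    (hu_pos : ∀ᵐ x ∂volume, 0 < u x) {I : Set ℝ} (hI : IsInterval I) :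
    ∃ E : ℝ → Set ℝ,
      (∀ t, 0 < t → ENNReal.ofReal t ≤ weight u I → NullMeasurableSet (E t) volume ∧ E t ⊆ I ∧
        weight u (E t) = ENNReal.ofReal t ∧ volume (E t) = phi u I t) ∧
      ∀ s t, 0 < s → s ≤ t → ENNReal.ofReal t ≤ weight u I → E s ⊆ E t := by
  have hum := hu.aestronglyMeasurable.aemeasurable
  have hex : ∀ t : ℝ, ∃ a : ℝ × ℝ, 0 < t → ENNReal.ofReal t < weight u I →
      0 < a.1 ∧ weight u (lexSegment u I (toLex a)) = ENNReal.ofReal t := fun t => by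
    by_cases h : 0 < t ∧ ENNReal.ofReal t < weight u I
    · obtain ⟨l, x, hl, hx⟩ := exists_lexSegment hu hu_pos hI (ENNReal.ofReal_pos.2 h.1) h.2
      exact ⟨(l, x), fun _ _ => ⟨hl, hx⟩⟩
    · exact ⟨0, fun h1 h2 => absurd ⟨h1, h2⟩ h⟩
  choose a ha using hex
  classical
  -- At the endpoint `t = u(I)` no segment is provided, and `I` itself is taken.
  refine ⟨fun t => if ENNReal.ofReal t < weight u I then lexSegment u I (toLex (a t)) else I,
    fun t ht0 ht => ?_, fun s t hs hst ht => ?_⟩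
  · have key : ∀ E : Set ℝ, NullMeasurableSet E volume → E ⊆ I → weight u E = ENNReal.ofReal t →
        (∀ F, NullMeasurableSet F volume → F ⊆ I → weight u F = ENNReal.ofReal t →
          volume F ≤ volume E) → NullMeasurableSet E volume ∧ E ⊆ I ∧
          weight u E = ENNReal.ofReal t ∧ volume E = phi u I t := by
      intro E h1 h2 h3 h4
      refine ⟨h1, h2, h3, le_antisymm (le_sSup ⟨E, h1, h2, ?_, rfl⟩) (sSup_le ?_)⟩
      · rw [wMeas_eq, h3]
      · rintro _ ⟨F, hF1, hF2, hF3, rfl⟩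
        exact h4 F hF1 hF2 (by rw [← wMeas_eq, hF3])
    by_cases h : ENNReal.ofReal t < weight u I
    · simp only [if_pos h]
      obtain ⟨hl, hx⟩ := ha t ht0 h
      exact key _ (nullMeasurableSet_lexSegment hum hI.measurableSet _ _) (fun y hy => hy.1) hx
        fun F h1 h2 h3 => volume_le_of_lexSegment hu hI hl h1 h2 (h3.trans hx.symm)
    · simp only [if_neg h]
      exact key _ hI.measurableSet.nullMeasurableSet Subset.rfl (le_antisymm (not_lt.1 h) ht)
        fun F _ h2 _ => measure_mono h2
  · by_cases h : ENNReal.ofReal t < weight u I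
    · have hs' : ENNReal.ofReal s < weight u I := (ENNReal.ofReal_le_ofReal hst).trans_lt h
      simp only [if_pos h, if_pos hs']
      rcases hst.eq_or_lt with rfl | hlt
      · exact Subset.rfl
      -- Segments form a chain, so the order of their weights decides the inclusion.
      rcases le_total (toLex (a s)) (toLex (a t)) with h' | h'
      · exact lexSegment_mono u I h'
      · have := measure_mono (μ := weight u) (lexSegment_mono u I h')
        rw [(ha s hs hs').2, (ha t (hs.trans hlt) h).2,
          ENNReal.ofReal_le_ofReal_iff hs.le] at this
        exact absurd this (not_le.2 hlt)
    · simp only [if_neg h]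
      split_ifs
      · exact fun y hy => hy.1
      · exact Subset.rfl

/-! ### The primitive of `w` -/

/-- The measure with density `w` on the half line. -/
def halfWeight (w : ℝ → ℝ) : Measure ℝ :=
  (volume.restrict (Ioi 0)).withDensity fun t => ENNReal.ofReal (w t)

instance (w : ℝ → ℝ) : NullSingletonClass (halfWeight w) := by unfold halfWeight; infer_instance

theorem initialSegment_subset_Ioi (r : ℝ≥0∞) : initialSegment r ⊆ Ioi 0 := fun _ h => h.1

theorem initialSegment_mono {r s : ℝ≥0∞} (h : r ≤ s) : initialSegment r ⊆ initialSegment s :=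
  fun _ ht => ⟨ht.1, ht.2.trans_le h⟩

theorem initialSegment_ofReal (r : ℝ) : initialSegment (ENNReal.ofReal r) = Ioo 0 r := by
  ext t
  constructor
  · exact fun h => ⟨h.1, (ENNReal.ofReal_lt_ofReal_iff'.1 h.2).1⟩
  · exact fun h => ⟨h.1, (ENNReal.ofReal_lt_ofReal_iff (h.1.trans h.2)).2 h.2⟩

theorem measurableSet_initialSegment (r : ℝ≥0∞) : MeasurableSet (initialSegment r) :=
  measurableSet_Ioi.inter (measurableSet_lt ENNReal.measurable_ofReal measurable_const)

theorem primitive_eq (w : ℝ → ℝ) (r : ℝ≥0∞) :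
    primitive w r = halfWeight w (initialSegment r) := by
  rw [halfWeight, withDensity_apply', Measure.restrict_restrict (measurableSet_initialSegment r),
    inter_eq_left.2 (initialSegment_subset_Ioi r), primitive]

theorem primitive_ofReal (w : ℝ → ℝ) (r : ℝ) :
    primitive w (ENNReal.ofReal r) = halfWeight w (Ioo 0 r) := by
  rw [primitive_eq, initialSegment_ofReal]

theorem primitive_mono (w : ℝ → ℝ) : Monotone (primitive w) := fun _ _ h => by
  rw [primitive_eq, primitive_eq]
  exact measure_mono (initialSegment_mono h)

theorem primitive_zero (w : ℝ → ℝ) : primitive w 0 = 0 := by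
  rw [primitive_eq, ← ENNReal.ofReal_zero, initialSegment_ofReal]
  simp

theorem aemeasurable_density {w : ℝ → ℝ} (hw : LocallyIntegrableOn w (Ioi 0) volume) :
    AEMeasurable (fun t => ENNReal.ofReal (w t)) (volume.restrict (Ioi 0)) :=
  hw.aestronglyMeasurable.aemeasurable.ennreal_ofReal

theorem lintegral_halfWeight {w : ℝ → ℝ} (hw : LocallyIntegrableOn w (Ioi 0) volume)
    (g : ℝ → ℝ≥0∞) :
    ∫⁻ t, g t ∂halfWeight w = ∫⁻ t in Ioi (0 : ℝ), g t * ENNReal.ofReal (w t) := by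
  rw [halfWeight, lintegral_withDensity_eq_lintegral_mul_non_measurable₀ _
    (aemeasurable_density hw) (Eventually.of_forall fun _ => ENNReal.ofReal_lt_top)]
  exact lintegral_congr fun t => mul_comm _ _

theorem setLIntegral_initialSegment {w : ℝ → ℝ} (hw : LocallyIntegrableOn w (Ioi 0) volume)
    (r : ℝ≥0∞) (g : ℝ → ℝ≥0∞) :
    ∫⁻ t in initialSegment r, g t * ENNReal.ofReal (w t) =
      ∫⁻ t in initialSegment r, g t ∂halfWeight w := by
  have hm := measurableSet_initialSegment r
  rw [← lintegral_indicator hm, ← lintegral_indicator hm, lintegral_halfWeight hw,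
    ← lintegral_indicator measurableSet_Ioi]
  refine lintegral_congr fun t => ?_
  by_cases ht : t ∈ initialSegment r
  · rw [indicator_of_mem ht, indicator_of_mem (initialSegment_subset_Ioi r ht),
      indicator_of_mem ht]
  · rw [indicator_of_notMem ht, indicator_apply, indicator_of_notMem ht, zero_mul, ite_self]

theorem halfWeight_Icc_ne_top {w : ℝ → ℝ} (hw : LocallyIntegrableOn w (Ioi 0) volume) {a b : ℝ}
    (ha : 0 < a) : halfWeight w (Icc a b) ≠ ∞ := by
  have hsub : Icc a b ⊆ Ioi 0 := fun t ht => ha.trans_le ht.1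
  have h := (hw.integrableOn_compact_subset hsub isCompact_Icc).2
  rw [halfWeight, withDensity_apply', Measure.restrict_restrict measurableSet_Icc,
    inter_eq_left.2 hsub]
  exact ((lintegral_mono fun t => Real.ofReal_le_enorm _).trans_lt h).ne

theorem primitive_ofReal_le_add (w : ℝ → ℝ) (a b : ℝ) :
    primitive w (ENNReal.ofReal b) ≤ primitive w (ENNReal.ofReal a) + halfWeight w (Ico a b) := by
  rw [primitive_ofReal, primitive_ofReal]
  refine (measure_mono fun t ht => ?_).trans (measure_union_le _ _)
  rcases lt_or_ge t a with h | h
  · exact Or.inl ⟨ht.1, h⟩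
  · exact Or.inr ⟨h, ht.2⟩

/-- If `W` is infinite at some finite point then it is infinite on `(0, ∞)`. -/
theorem primitive_eq_top {w : ℝ → ℝ} (hw : LocallyIntegrableOn w (Ioi 0) volume) {r s : ℝ≥0∞}
    (hr : r ≠ ∞) (h : primitive w r = ∞) (hs : s ≠ 0) : primitive w s = ∞ := by
  rcases le_total r s with hrs | hsr
  · exact top_le_iff.1 (h ▸ primitive_mono w hrs)
  have hs' : s ≠ ∞ := ne_top_of_le_ne_top hr hsr
  lift r to ℝ≥0 using hr
  lift s to ℝ≥0 using hs'
  have h1 := primitive_ofReal_le_add w s r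
  rw [ENNReal.ofReal_coe_nnreal, ENNReal.ofReal_coe_nnreal, h, top_le_iff] at h1
  -- Away from 0 the integral of `w` is finite, so the divergence sits at 0.
  refine (ENNReal.add_eq_top.1 h1).resolve_right ?_
  refine measure_ne_top_of_subset Ico_subset_Icc_self (halfWeight_Icc_ne_top hw ?_)
  exact_mod_cast pos_iff_ne_zero.2 hs

/-- `W` takes every value up to `W(t)` on `[0, t]`. -/
theorem exists_primitive_eq {w : ℝ → ℝ} {t : ℝ} (ht : 0 ≤ t)
    (hfin : primitive w (ENNReal.ofReal t) ≠ ∞) {c : ℝ≥0∞}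
    (hc : c ≤ primitive w (ENNReal.ofReal t)) :
    ∃ s, 0 ≤ s ∧ s ≤ t ∧ primitive w (ENNReal.ofReal s) = c := by
  rw [primitive_ofReal] at hfin hc
  obtain ⟨x, hx⟩ := exists_measure_inter_Iio_eq (Metric.isBounded_Ioo 0 t) hfin hc
  refine ⟨max 0 (min t x), le_max_left _ _, max_le ht (min_le_left _ _), ?_⟩
  rw [primitive_ofReal, ← hx]
  congr 1
  ext s
  simp only [mem_Ioo, lt_max_iff, lt_min_iff, mem_inter_iff, mem_Iio]
  constructor
  · rintro ⟨h1, h2 | h2⟩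
    · exact absurd h1 h2.le.not_gt
    · exact ⟨⟨h1, h2.1⟩, h2.2⟩
  · exact fun h => ⟨h.1.1, Or.inr ⟨h.1.2, h.2⟩⟩

/-- If the sublevel set had mass above `c`, a part of it to the left of some `x` would have mass `d
> c`, and a point `s ≥ x` of the set would satisfy `W(s) ≥ d > c`. -/
theorem halfWeight_sublevel_le {w : ℝ → ℝ} {t : ℝ}
    (hfin : primitive w (ENNReal.ofReal t) ≠ ∞) (c : ℝ≥0∞) :
    halfWeight w {s | s ∈ Ioo 0 t ∧ primitive w (ENNReal.ofReal s) ≤ c} ≤ c := by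
  set S := {s | s ∈ Ioo 0 t ∧ primitive w (ENNReal.ofReal s) ≤ c} with hS
  have hsub : S ⊆ Ioo 0 t := fun s hs => hs.1
  have hSfin : halfWeight w S ≠ ∞ :=
    measure_ne_top_of_subset hsub (by rwa [primitive_ofReal] at hfin)
  by_contra hlt
  obtain ⟨d, hcd, hd⟩ := exists_between (not_le.1 hlt)
  obtain ⟨x, hx⟩ := exists_measure_inter_Iio_eq ((Metric.isBounded_Ioo 0 t).subset hsub) hSfin hd.le
  have : ∃ s ∈ S, x ≤ s := by
    by_contra hne
    push Not at hne
    rw [inter_eq_left.2 (show S ⊆ Iio x from hne)] at hx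
    exact hd.ne hx.symm
  obtain ⟨s, hs, hxs⟩ := this
  have h1 : d ≤ primitive w (ENNReal.ofReal s) := by
    rw [← hx, primitive_ofReal]
    exact measure_mono fun y hy => ⟨hy.1.1.1, hy.2.trans_le hxs⟩
  exact absurd (h1.trans hs.2) (not_le.2 hcd)

/-! ### The quasi-norm -/

theorem lorentzNorm_rpow {p : ℝ} (hp : 0 < p) (u : ℝ → ℝ) {w : ℝ → ℝ}
    (hw : LocallyIntegrableOn w (Ioi 0) volume) (f : ℝ → ℝ) :
    lorentzNorm p u w f ^ p = ∫⁻ t, rearrangement u f t ^ p ∂halfWeight w := by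
  rw [lorentzNorm, one_div, ENNReal.rpow_inv_rpow hp.ne', lintegral_halfWeight hw]

theorem le_rearrangement {u f : ℝ → ℝ} {t : ℝ} {s : ℝ≥0∞}
    (h : ENNReal.ofReal t < wMeas u {x | s < ENNReal.ofReal |f x|}) :
    s ≤ rearrangement u f t := by
  refine le_sInf fun r hr => not_lt.1 fun hrs => ?_
  refine absurd (h.trans_le ?_) (not_lt.2 hr)
  rw [wMeas_eq, wMeas_eq]
  exact measure_mono fun x hx => hrs.trans hx

theorem rearrangement_le {u f : ℝ → ℝ} {t : ℝ} {s : ℝ≥0∞}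
    (h : wMeas u {x | s < ENNReal.ofReal |f x|} ≤ ENNReal.ofReal t) :
    rearrangement u f t ≤ s := sInf_le h

theorem ae_mem_Ioi_halfWeight (w : ℝ → ℝ) : ∀ᵐ t ∂halfWeight w, t ∈ Ioi (0 : ℝ) :=
  (withDensity_absolutelyContinuous _ _).ae_le (ae_restrict_mem measurableSet_Ioi)

/-- If `t < u({|f| > 2^j})` then `2^j ≤ f*_u(t)`. At fixed `t` the sum of these `2^{jp}` is
geometric, of size `f*_u(t)^p`; then integrate against `w`. -/
theorem tsum_two_rpow_mul_primitive_le {p : ℝ} (hp : 0 < p) (u : ℝ → ℝ) {w : ℝ → ℝ}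
    (hw : LocallyIntegrableOn w (Ioi 0) volume) (f : ℝ → ℝ) :
    ∑' j : ℤ, (2 : ℝ≥0∞) ^ ((j : ℝ) * p) *
        primitive w (wMeas u {x | (2 : ℝ≥0∞) ^ (j : ℝ) < ENNReal.ofReal |f x|}) ≤
      geomConst p * lorentzNorm p u w f ^ p := by
  have hK := geomConst_ne_top hp
  rw [lorentzNorm_rpow hp u hw, ← lintegral_const_mul' _ _ hK]
  calc _ = ∑' j : ℤ, ∫⁻ t, (initialSegment (wMeas u {x | (2 : ℝ≥0∞) ^ (j : ℝ) <
          ENNReal.ofReal |f x|})).indicator (fun _ => (2 : ℝ≥0∞) ^ ((j : ℝ) * p)) t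
          ∂halfWeight w := by
        refine tsum_congr fun j => ?_
        rw [lintegral_indicator_const (measurableSet_initialSegment _), primitive_eq]
    _ = ∫⁻ t, ∑' j : ℤ, (initialSegment (wMeas u {x | (2 : ℝ≥0∞) ^ (j : ℝ) <
          ENNReal.ofReal |f x|})).indicator (fun _ => (2 : ℝ≥0∞) ^ ((j : ℝ) * p)) t
          ∂halfWeight w :=
        (lintegral_tsum fun j =>
          (measurable_const.indicator (measurableSet_initialSegment _)).aemeasurable).symm
    _ ≤ _ := by
        refine lintegral_mono fun t => le_trans (ENNReal.tsum_le_tsum fun j => ?_)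
          (tsum_two_rpow_le_rpow hp (rearrangement u f t))
        by_cases ht : t ∈ initialSegment (wMeas u {x | (2 : ℝ≥0∞) ^ (j : ℝ) <
          ENNReal.ofReal |f x|})
        · rw [indicator_of_mem ht, indicator_of_mem]
          exact le_rearrangement ht.2
        · rw [indicator_of_notMem ht]
          exact zero_le

theorem lorentzNorm_indicator {p : ℝ} (hp : 0 < p) (u : ℝ → ℝ) {w : ℝ → ℝ}
    (hw : LocallyIntegrableOn w (Ioi 0) volume) (E : Set ℝ) :
    lorentzNorm p u w (E.indicator fun _ => 1) = primitive w (wMeas u E) ^ (1 / p) := by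
  have h1 : ∀ s : ℝ≥0∞, s < 1 →
      {x | s < ENNReal.ofReal |E.indicator (fun _ => (1 : ℝ)) x|} = E := fun s hs => by
    ext x
    by_cases hx : x ∈ E <;> simp [hx, hs]
  have h2 : {x | (1 : ℝ≥0∞) < ENNReal.ofReal |E.indicator (fun _ => (1 : ℝ)) x|} = ∅ := by
    ext x
    by_cases hx : x ∈ E <;> simp [hx]
  have key : ∀ t ∈ Ioi (0 : ℝ), rearrangement u (E.indicator fun _ => 1) t ^ p =
      (initialSegment (wMeas u E)).indicator (fun _ => (1 : ℝ≥0∞)) t := fun t ht => by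
    by_cases h : ENNReal.ofReal t < wMeas u E
    · rw [indicator_of_mem (show t ∈ initialSegment (wMeas u E) from ⟨ht, h⟩)]
      suffices rearrangement u (E.indicator fun _ => 1) t = 1 by rw [this, ENNReal.one_rpow]
      refine le_antisymm (rearrangement_le ?_) ?_
      · rw [h2, wMeas_eq, measure_empty]
        exact zero_le
      · exact le_of_forall_lt_imp_le_of_dense fun s hs => le_rearrangement (by rwa [h1 s hs])
    · rw [indicator_of_notMem (fun h' : t ∈ initialSegment (wMeas u E) => h h'.2)]
      suffices rearrangement u (E.indicator fun _ => 1) t = 0 by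
        rw [this, ENNReal.zero_rpow_of_pos hp]
      refine le_antisymm (rearrangement_le ?_) zero_le
      rw [h1 0 zero_lt_one]
      exact not_lt.1 h
  rw [← ENNReal.rpow_rpow_inv hp.ne' (lorentzNorm _ _ _ _), lorentzNorm_rpow hp u hw, one_div,
    lintegral_congr_ae ((ae_mem_Ioi_halfWeight w).mono key),
    lintegral_indicator_const (measurableSet_initialSegment _), one_mul, primitive_eq]

theorem setLIntegral_le_tsum {I : Set ℝ} (hI : MeasurableSet I) {f : ℝ → ℝ}
    (hf : AEMeasurable f volume) :
    ∫⁻ x in I, ENNReal.ofReal |f x| ≤ 2 * ∑' j : ℤ, (2 : ℝ≥0∞) ^ (j : ℝ) *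
      volume ({x | (2 : ℝ≥0∞) ^ (j : ℝ) < ENNReal.ofReal |f x|} ∩ I) := by
  have hm : ∀ j : ℤ, NullMeasurableSet {x | (2 : ℝ≥0∞) ^ (j : ℝ) < ENNReal.ofReal |f x|}
      (volume.restrict I) := fun j =>
    nullMeasurableSet_lt aemeasurable_const
      (measurable_norm.comp_aemeasurable hf).ennreal_ofReal.restrict
  calc _ ≤ ∫⁻ x in I, ∑' j : ℤ, 2 * {x | (2 : ℝ≥0∞) ^ (j : ℝ) <
          ENNReal.ofReal |f x|}.indicator (fun _ => (2 : ℝ≥0∞) ^ (j : ℝ)) x :=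
        lintegral_mono fun x => le_tsum_two_rpow ENNReal.ofReal_ne_top
    _ = _ := by
        rw [lintegral_tsum fun j => (aemeasurable_const.indicator₀ (hm j)).const_mul _,
          ← ENNReal.tsum_mul_left]
        refine tsum_congr fun j => ?_
        rw [lintegral_const_mul' _ _ (by norm_num), lintegral_indicator_const₀ (hm j),
          Measure.restrict_apply' hI]

/-! ### The pairing -/

theorem mul_inv_indicator_ae_eq {u : ℝ → ℝ} (hu_pos : ∀ᵐ x ∂volume, 0 < u x) (I : Set ℝ)
    (f : ℝ → ℝ) :
    (fun x => f x * I.indicator (fun x => (u x)⁻¹) x * u x) =ᵐ[volume] I.indicator f := by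
  filter_upwards [hu_pos] with x hx
  by_cases h : x ∈ I
  · simp only [indicator_of_mem h]
    field_simp
  · simp [indicator_of_notMem h]

theorem absPairing_le {u : ℝ → ℝ} (hu_pos : ∀ᵐ x ∂volume, 0 < u x) {I : Set ℝ}
    (hI : MeasurableSet I) {f : ℝ → ℝ} (hf : AEMeasurable f volume) :
    absPairing u f (I.indicator fun x => (u x)⁻¹) ≤ ∫⁻ x in I, ENNReal.ofReal |f x| := by
  have hae := mul_inv_indicator_ae_eq hu_pos I f
  have henorm : ∫⁻ x in I, ENNReal.ofReal |f x| = ∫⁻ x in I, ‖f x‖ₑ :=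
    lintegral_congr fun x => by rw [Real.enorm_eq_ofReal_abs]
  rw [absPairing]
  split_ifs with h
  · rw [integral_congr_ae hae, integral_indicator hI, ← Real.enorm_eq_ofReal_abs, henorm]
    exact enorm_integral_le_lintegral_enorm _
  · rw [integrable_congr hae, integrable_indicator_iff hI] at h
    rw [top_le_iff, henorm]
    by_contra hne
    exact h ⟨hf.aestronglyMeasurable.restrict, lt_top_iff_ne_top.2 hne⟩

theorem le_absPairing {u : ℝ → ℝ} (hu_pos : ∀ᵐ x ∂volume, 0 < u x) {I : Set ℝ}
    (hI : MeasurableSet I) {f : ℝ → ℝ} (hf : ∀ x, 0 ≤ f x) :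
    ∫⁻ x in I, ENNReal.ofReal (f x) ≤ absPairing u f (I.indicator fun x => (u x)⁻¹) := by
  have hae := mul_inv_indicator_ae_eq hu_pos I f
  rw [absPairing]
  split_ifs with h
  · rw [integral_congr_ae hae, integral_indicator hI, abs_of_nonneg (integral_nonneg hf)]
    rw [integrable_congr hae, integrable_indicator_iff hI] at h
    rw [ofReal_integral_eq_lintegral_ofReal h (Eventually.of_forall hf)]
  · exact le_top

/-- An upper bound for the associate norm of `u⁻¹ χ_I`. -/
theorem associateNorm_mul_le {p : ℝ} {u w : ℝ → ℝ} (hu_pos : ∀ᵐ x ∂volume, 0 < u x) {I : Set ℝ}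
    (hI : MeasurableSet I) {V B : ℝ≥0∞}
    (h : ∀ f ∈ lorentzSpace p u w,
      (∫⁻ x in I, ENNReal.ofReal |f x|) * V ≤ B * lorentzNorm p u w f) :
    associateNorm p u w (I.indicator fun x => (u x)⁻¹) * V ≤ B := by
  simp only [associateNorm, ENNReal.iSup_mul]
  refine iSup₂_le fun f hf => ?_
  rw [ENNReal.mul_comm_div, mul_comm, ENNReal.mul_comm_div, ← mul_div_assoc]
  refine ENNReal.div_le_of_le_mul (le_trans ?_ (h f hf))
  rw [mul_comm]
  gcongr
  exact absPairing_le hu_pos hI hf.1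

/-- A lower bound for the associate norm of `u⁻¹ χ_I`. -/
theorem setLIntegral_div_le_associateNorm {p : ℝ} {u w : ℝ → ℝ}
    (hu_pos : ∀ᵐ x ∂volume, 0 < u x) {I : Set ℝ} (hI : MeasurableSet I) {f : ℝ → ℝ}
    (hf : f ∈ lorentzSpace p u w) (hf0 : ∀ x, 0 ≤ f x) :
    (∫⁻ x in I, ENNReal.ofReal (f x)) / lorentzNorm p u w f ≤
      associateNorm p u w (I.indicator fun x => (u x)⁻¹) := by
  refine le_trans ?_ (le_iSup₂ (f := fun f (_ : f ∈ lorentzSpace p u w) =>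
    absPairing u f (I.indicator fun x => (u x)⁻¹) / lorentzNorm p u w f) f hf)
  exact ENNReal.div_le_div_right (le_absPairing hu_pos hI hf0) _

/-! ### The case `p ≤ 1` -/

theorem dualityCondition_of_le {p : ℝ} (hp : 0 < p) {u w : ℝ → ℝ}
    (hw : LocallyIntegrableOn w (Ioi 0) volume) (hu_pos : ∀ᵐ x ∂volume, 0 < u x) {D : ℝ≥0∞}
    (hD : D ≠ ∞)
    (h : ∀ I, IsInterval I → ∀ f ∈ lorentzSpace p u w,
      (∫⁻ x in I, ENNReal.ofReal |f x|) * primitive w (wMeas u I) ^ (1 / p) ≤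
        D * volume I * lorentzNorm p u w f) :
    DualityCondition p u w := by
  -- Adding 1 keeps the constant positive when `D = 0`.
  refine ⟨D.toNNReal + 1, by positivity, fun I hI => ?_⟩
  rw [lorentzNorm_indicator hp u hw]
  refine (associateNorm_mul_le hu_pos hI.measurableSet (h I hI)).trans ?_
  gcongr
  push_cast
  rw [ENNReal.coe_toNNReal hD]
  exact le_self_add

theorem indicator_one_mem_lorentzSpace {p : ℝ} (hp : 0 < p) {u w : ℝ → ℝ}
    (hw : LocallyIntegrableOn w (Ioi 0) volume) {E : Set ℝ} (hE : NullMeasurableSet E volume)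
    (hfin : primitive w (wMeas u E) ≠ ∞) :
    (E.indicator fun _ => (1 : ℝ)) ∈ lorentzSpace p u w := by
  refine ⟨aemeasurable_const.indicator₀ hE, ?_⟩
  rw [lorentzNorm_indicator hp u hw]
  exact ENNReal.rpow_lt_top_of_nonneg (by positivity) hfin

theorem volume_div_le_associateNorm {p : ℝ} (hp : 0 < p) {u w : ℝ → ℝ}
    (hw : LocallyIntegrableOn w (Ioi 0) volume) (hu_pos : ∀ᵐ x ∂volume, 0 < u x) {I E : Set ℝ}
    (hI : MeasurableSet I) (hE : NullMeasurableSet E volume) (hEI : E ⊆ I)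
    (hfin : primitive w (wMeas u E) ≠ ∞) :
    volume E / primitive w (wMeas u E) ^ (1 / p) ≤
      associateNorm p u w (I.indicator fun x => (u x)⁻¹) := by
  have h := setLIntegral_div_le_associateNorm hu_pos hI
    (indicator_one_mem_lorentzSpace hp hw hE hfin)
    (fun x => indicator_nonneg (fun _ _ => zero_le_one) x)
  rw [lorentzNorm_indicator hp u hw] at h
  convert h using 2
  have : ∀ x, ENNReal.ofReal (E.indicator (fun _ => (1 : ℝ)) x) =
      E.indicator (fun _ => (1 : ℝ≥0∞)) x := fun x => by
    by_cases hx : x ∈ E <;> simp [hx]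
  simp only [this]
  rw [lintegral_indicator_const₀ (hE.mono_ac Measure.absolutelyContinuous_restrict), one_mul,
    Measure.restrict_apply' hI, inter_eq_left.2 hEI]

theorem quasiconcaveCondition_of_dualityCondition {p : ℝ} (hp : 0 < p) {u w : ℝ → ℝ}
    (hw : LocallyIntegrableOn w (Ioi 0) volume) (hu_pos : ∀ᵐ x ∂volume, 0 < u x)
    (h : DualityCondition p u w) : QuasiconcaveCondition p u w := by
  obtain ⟨C, hC, h⟩ := h
  refine ⟨C ^ p, NNReal.rpow_pos hC, fun I hI E hE hEI => ?_⟩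
  rw [ENNReal.coe_rpow_of_nonneg _ hp.le]
  rcases eq_or_ne (volume E) 0 with h0 | h0
  · rw [h0, ENNReal.div_zero hI.volume_pos.ne', ENNReal.top_rpow_of_pos hp, ENNReal.mul_top]
    · exact le_top
    · exact (ENNReal.rpow_pos (by exact_mod_cast hC) ENNReal.coe_ne_top).ne'
  -- Here `χ_E` is not an admissible test function, but the quotient is 0, also when it is `∞/∞`.
  rcases eq_or_ne (primitive w (wMeas u E)) ∞ with ht | ht
  · simp [ht]
  have hEfin : volume E ≠ ∞ := measure_ne_top_of_subset hEI hI.volume_ne_top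
  have h1 := (mul_le_mul_left (volume_div_le_associateNorm hp hw hu_pos hI.measurableSet hE hEI ht)
    (primitive w (wMeas u I) ^ (1 / p))).trans
      ((congrArg _ (lorentzNorm_indicator hp u hw I)).symm.trans_le (h I hI))
  have h2 := ENNReal.rpow_le_rpow h1 hp.le
  rw [ENNReal.mul_rpow_of_nonneg _ _ hp.le, ENNReal.div_rpow_of_nonneg _ _ hp.le,
    ENNReal.mul_rpow_of_nonneg _ _ hp.le, one_div, ENNReal.rpow_inv_rpow hp.ne',
    ENNReal.rpow_inv_rpow hp.ne'] at h2
  rw [ENNReal.div_rpow_of_nonneg _ _ hp.le, ← mul_div_assoc, ENNReal.le_div_iff_mul_le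
    (Or.inl (ENNReal.rpow_pos (pos_iff_ne_zero.2 h0) hEfin).ne')
    (Or.inl (ENNReal.rpow_ne_top_of_nonneg hp.le hEfin))]
  refine le_trans (le_of_eq ?_) h2
  simp only [div_eq_mul_inv]
  ring

theorem dualityCondition_of_quasiconcaveCondition {p : ℝ} (hp : 0 < p) (hp1 : p ≤ 1)
    {u w : ℝ → ℝ} (hw : LocallyIntegrableOn w (Ioi 0) volume)
    (hu_pos : ∀ᵐ x ∂volume, 0 < u x) (h : QuasiconcaveCondition p u w) :
    DualityCondition p u w := by
  obtain ⟨C, hC, h⟩ := h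
  -- The 2 is lost in the dyadic decomposition, `C` comes from (b), and `geomConst p` from the sum
  -- over the levels.
  refine dualityCondition_of_le hp hw hu_pos (D := (2 ^ p * (C * geomConst p)) ^ p⁻¹) ?_ ?_
  · exact ENNReal.rpow_ne_top_of_nonneg (by positivity) (ENNReal.mul_ne_top (two_rpow_ne_top p)
      (ENNReal.mul_ne_top ENNReal.coe_ne_top (geomConst_ne_top hp)))
  intro I hI f hf
  set W1 := primitive w (wMeas u I) with hW1
  -- This is (b) without denominators. When `|E| > 0`, (b) excludes `W(u(E)) = 0 < W(u(I))`, since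
  -- the quotient would be infinite.
  have hset : ∀ E : Set ℝ, NullMeasurableSet E volume → E ⊆ I →
      volume E ^ p * W1 ≤ C * volume I ^ p * primitive w (wMeas u E) := fun E hE hEI => by
    have hEfin : volume E ≠ ∞ := measure_ne_top_of_subset hEI hI.volume_ne_top
    rcases eq_or_ne (volume E) 0 with h0 | h0
    · simp [h0, hp]
    have hEp : volume E ^ p ≠ 0 := (ENNReal.rpow_pos (pos_iff_ne_zero.2 h0) hEfin).ne'
    have hEp' : volume E ^ p ≠ ∞ := ENNReal.rpow_ne_top_of_nonneg hp.le hEfin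
    have hI0 : (C : ℝ≥0∞) * volume I ^ p ≠ 0 := mul_ne_zero (by exact_mod_cast hC.ne')
      (ENNReal.rpow_pos hI.volume_pos hI.volume_ne_top).ne'
    have hIfin : (C : ℝ≥0∞) * volume I ^ p ≠ ∞ := ENNReal.mul_ne_top ENNReal.coe_ne_top
      (ENNReal.rpow_ne_top_of_nonneg hp.le hI.volume_ne_top)
    have h1 := h I hI E hE hEI
    rw [ENNReal.div_rpow_of_nonneg _ _ hp.le, ← mul_div_assoc,
      ENNReal.le_div_iff_mul_le (Or.inl hEp) (Or.inl hEp')] at h1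
    rcases eq_or_ne (primitive w (wMeas u E)) ∞ with ht | ht
    · rw [ht, ENNReal.mul_top hI0]
      exact le_top
    rcases eq_or_ne (primitive w (wMeas u E)) 0 with hz | hz
    · rcases eq_or_ne W1 0 with hW | hW
      · simp [hW]
      · rw [← hW1, hz, ENNReal.div_zero hW, ENNReal.top_mul hEp] at h1
        exact absurd (top_le_iff.1 h1) hIfin
    · rw [← hW1, ENNReal.mul_comm_div, mul_comm, ENNReal.mul_comm_div, ← mul_div_assoc,
        ENNReal.div_le_iff hz ht, mul_comm] at h1
      rwa [mul_comm] at h1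
  have hX : (∫⁻ x in I, ENNReal.ofReal |f x|) ^ p * W1 ≤
      2 ^ p * (C * geomConst p) * (volume I ^ p * lorentzNorm p u w f ^ p) := by
    set E : ℤ → Set ℝ := fun j => {x | (2 : ℝ≥0∞) ^ (j : ℝ) < ENNReal.ofReal |f x|}
    have hE : ∀ j, NullMeasurableSet (E j ∩ I) volume := fun j =>
      (nullMeasurableSet_lt aemeasurable_const
        (measurable_norm.comp_aemeasurable hf.1).ennreal_ofReal).inter
        hI.measurableSet.nullMeasurableSet
    calc _ ≤ (2 * ∑' j : ℤ, (2 : ℝ≥0∞) ^ (j : ℝ) * volume (E j ∩ I)) ^ p * W1 := by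
          gcongr
          exact setLIntegral_le_tsum hI.measurableSet hf.1
      _ ≤ 2 ^ p * (∑' j : ℤ, ((2 : ℝ≥0∞) ^ (j : ℝ) * volume (E j ∩ I)) ^ p) * W1 := by
          rw [ENNReal.mul_rpow_of_nonneg _ _ hp.le]
          gcongr
          exact tsum_rpow_le hp hp1 _
      _ = 2 ^ p * ∑' j : ℤ, (2 : ℝ≥0∞) ^ ((j : ℝ) * p) * (volume (E j ∩ I) ^ p * W1) := by
          rw [mul_assoc, ← ENNReal.tsum_mul_right]
          congr 1
          refine tsum_congr fun j => ?_
          rw [ENNReal.mul_rpow_of_nonneg _ _ hp.le, ENNReal.rpow_mul, mul_assoc]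
      _ ≤ 2 ^ p * ∑' j : ℤ, C * volume I ^ p *
            ((2 : ℝ≥0∞) ^ ((j : ℝ) * p) * primitive w (wMeas u (E j))) := by
          refine mul_le_mul_right (ENNReal.tsum_le_tsum fun j => ?_) _
          refine (mul_le_mul_right (hset _ (hE j) inter_subset_right) _).trans ?_
          rw [mul_left_comm]
          gcongr
          refine primitive_mono w ?_
          rw [wMeas_eq, wMeas_eq]
          exact measure_mono inter_subset_left
      _ ≤ 2 ^ p * (C * volume I ^ p * (geomConst p * lorentzNorm p u w f ^ p)) := by
          rw [ENNReal.tsum_mul_left]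
          gcongr
          exact tsum_two_rpow_mul_primitive_le hp u hw f
      _ = _ := by ring
  have h3 := ENNReal.rpow_le_rpow hX (inv_nonneg.2 hp.le)
  have hi : 0 ≤ p⁻¹ := inv_nonneg.2 hp.le
  rw [ENNReal.mul_rpow_of_nonneg _ _ hi, ENNReal.mul_rpow_of_nonneg (2 ^ p * _) _ hi,
    ENNReal.mul_rpow_of_nonneg (volume I ^ p) _ hi, ENNReal.rpow_rpow_inv hp.ne',
    ENNReal.rpow_rpow_inv hp.ne', ENNReal.rpow_rpow_inv hp.ne', ← mul_assoc] at h3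
  rwa [one_div]

/-! ### The case `p > 1`: sufficiency of the integral condition -/

theorem phi_mono {u : ℝ → ℝ} (hu : LocallyIntegrable u volume)
    (hu_pos : ∀ᵐ x ∂volume, 0 < u x) {I : Set ℝ} (hI : IsInterval I) {s t : ℝ} (hs : 0 < s)
    (hst : s ≤ t) (ht : ENNReal.ofReal t ≤ weight u I) : phi u I s ≤ phi u I t := by
  obtain ⟨E, hE, hmono⟩ := exists_extremal_family hu hu_pos hI
  rw [← (hE s hs ((ENNReal.ofReal_le_ofReal hst).trans ht)).2.2.2,
    ← (hE t (hs.trans_le hst) ht).2.2.2]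
  exact measure_mono (hmono s t hs hst ht)

theorem phi_le_volume (u : ℝ → ℝ) (I : Set ℝ) (t : ℝ) : phi u I t ≤ volume I := by
  refine sSup_le ?_
  rintro _ ⟨F, -, hF, -, rfl⟩
  exact measure_mono hF

theorem phi_pos {u : ℝ → ℝ} (hu : LocallyIntegrable u volume)
    (hu_pos : ∀ᵐ x ∂volume, 0 < u x) {I : Set ℝ} (hI : IsInterval I) {t : ℝ} (ht0 : 0 < t)
    (ht : ENNReal.ofReal t ≤ weight u I) : 0 < phi u I t := by
  obtain ⟨E, hE, -⟩ := exists_extremal_family hu hu_pos hI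
  obtain ⟨-, -, h1, h2⟩ := hE t ht0 ht
  rw [← h2, pos_iff_ne_zero]
  intro h
  rw [weight_absolutelyContinuous u h] at h1
  exact absurd h1.symm (by simpa using ht0)

/-- The function `φ_I / W`. -/
def hardyRatio (u w : ℝ → ℝ) (I : Set ℝ) (t : ℝ) : ℝ≥0∞ :=
  phi u I t / primitive w (ENNReal.ofReal t)

theorem primitive_comp_ofReal_mono (w : ℝ → ℝ) :
    Monotone fun t : ℝ => primitive w (ENNReal.ofReal t) :=
  (primitive_mono w).comp fun _ _ h => ENNReal.ofReal_le_ofReal h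

theorem aemeasurable_hardyRatio {u : ℝ → ℝ} (hu : LocallyIntegrable u volume)
    (hu_pos : ∀ᵐ x ∂volume, 0 < u x) (w : ℝ → ℝ) {I : Set ℝ} (hI : IsInterval I)
    (m : Measure ℝ) :
    AEMeasurable (hardyRatio u w I) (m.restrict (initialSegment (weight u I))) := by
  refine AEMeasurable.div ?_ (primitive_comp_ofReal_mono w).measurable.aemeasurable
  exact aemeasurable_restrict_of_monotoneOn (measurableSet_initialSegment _)
    fun s hs t ht hst => phi_mono hu hu_pos hI hs.1 hst ht.2.le

/-- Choose `t` with `W(t) = c`. On `[a, t)` one has `φ_I ≥ φ_I(a)` and `W ≤ c`, and this interval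
has `w`-mass at least `c - W(a)`. If `t ≤ a`, the truncated difference is 0. -/
theorem hardyRatio_lower_bound {u : ℝ → ℝ} (hu : LocallyIntegrable u volume)
    (hu_pos : ∀ᵐ x ∂volume, 0 < u x) {w : ℝ → ℝ} {I : Set ℝ} (hI : IsInterval I)
    (hfin : primitive w (weight u I) ≠ ∞) {q : ℝ} (hq : 0 ≤ q) {a : ℝ} (ha : 0 < a)
    {c : ℝ≥0∞} (hc : c ≤ primitive w (weight u I)) :
    (phi u I a / c) ^ q * (c - primitive w (ENNReal.ofReal a)) ≤
      ∫⁻ s in initialSegment (weight u I) ∩ {s | primitive w (ENNReal.ofReal s) ≤ c},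
        hardyRatio u w I s ^ q ∂halfWeight w := by
  have hIt : weight u I = ENNReal.ofReal (weight u I).toReal :=
    (ENNReal.ofReal_toReal (weight_ne_top hu hI.2.1)).symm
  obtain ⟨t, ht0, ht1, ht⟩ := exists_primitive_eq (w := w) (t := (weight u I).toReal) (c := c)
    ENNReal.toReal_nonneg (hIt ▸ hfin) (hIt ▸ hc)
  have hsub : Ico a t ⊆ initialSegment (weight u I) ∩
      {s | primitive w (ENNReal.ofReal s) ≤ c} := fun s hs => by
    refine ⟨?_, ?_⟩
    · rw [hIt, initialSegment_ofReal]
      exact ⟨ha.trans_le hs.1, hs.2.trans_le ht1⟩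
    · exact (primitive_comp_ofReal_mono w hs.2.le).trans_eq ht
  calc _ ≤ (phi u I a / c) ^ q * halfWeight w (Ico a t) := by
        gcongr
        rw [tsub_le_iff_left, ← ht]
        exact primitive_ofReal_le_add w a t
    _ = ∫⁻ _ in Ico a t, (phi u I a / c) ^ q ∂halfWeight w := by simp
    _ ≤ ∫⁻ s in Ico a t, hardyRatio u w I s ^ q ∂halfWeight w := by
        refine setLIntegral_mono' measurableSet_Ico fun s hs => ?_
        refine ENNReal.rpow_le_rpow (ENNReal.div_le_div ?_ (hsub hs).2) hq
        exact phi_mono hu hu_pos hI ha hs.1 (hsub hs).1.2.le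
    _ ≤ _ := lintegral_mono_set hsub

/-- If `W(a) = 0`, the lower bound reads `φ_I(a)^q ≤ H c^{q-1}` for all small `c > 0`, with `H` the
finite integral. Letting `c → 0` contradicts `φ_I(a) > 0`. -/
theorem primitive_ne_zero_of_hardy {u : ℝ → ℝ} (hu : LocallyIntegrable u volume)
    (hu_pos : ∀ᵐ x ∂volume, 0 < u x) {w : ℝ → ℝ} {I : Set ℝ} (hI : IsInterval I)
    (h0 : primitive w (weight u I) ≠ 0) (hfin : primitive w (weight u I) ≠ ∞) {q : ℝ} (hq : 1 < q)
    (hH : ∫⁻ s in initialSegment (weight u I), hardyRatio u w I s ^ q ∂halfWeight w ≠ ∞) {a : ℝ}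
    (ha : 0 < a) (haI : ENNReal.ofReal a ≤ weight u I) :
    primitive w (ENNReal.ofReal a) ≠ 0 := by
  intro hz
  set H := ∫⁻ s in initialSegment (weight u I), hardyRatio u w I s ^ q ∂halfWeight w
  have hphi := phi_pos hu hu_pos hI ha haI
  have hphit : phi u I a ≠ ∞ := ne_top_of_le_ne_top hI.volume_ne_top (phi_le_volume u I a)
  have key : ∀ c : ℝ≥0∞, c ≠ 0 → c ≤ primitive w (weight u I) →
      phi u I a ^ q ≤ H * c ^ (q - 1) := fun c hc0 hc => by
    have hct : c ≠ ∞ := ne_top_of_le_ne_top hfin hc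
    have h := (hardyRatio_lower_bound hu hu_pos hI hfin (by linarith : 0 ≤ q) ha hc).trans
      (lintegral_mono_set inter_subset_left)
    rw [hz, tsub_zero] at h
    have hcq : c ^ q = c * c ^ (q - 1) := by
      conv_lhs => rw [show q = 1 + (q - 1) by ring, ENNReal.rpow_add _ _ hc0 hct, ENNReal.rpow_one]
    calc phi u I a ^ q = (phi u I a / c) ^ q * c * c ^ (q - 1) := by
          rw [mul_assoc, ← hcq, ← ENNReal.mul_rpow_of_nonneg _ _ (by linarith),
            ENNReal.div_mul_cancel hc0 hct]
      _ ≤ _ := by gcongr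
  have hlim : Tendsto (fun n : ℕ => H * ((n : ℝ≥0∞)⁻¹) ^ (q - 1)) atTop (𝓝 0) := by
    have h1 := ((ENNReal.continuous_rpow_const (y := q - 1)).tendsto 0).comp
      ENNReal.tendsto_inv_nat_nhds_zero
    rw [ENNReal.zero_rpow_of_pos (by linarith)] at h1
    simpa using ENNReal.Tendsto.const_mul h1 (Or.inr hH)
  have hev := (hlim.eventually (gt_mem_nhds (ENNReal.rpow_pos (p := q) hphi hphit))).and
    (ENNReal.tendsto_inv_nat_nhds_zero.eventually (gt_mem_nhds (pos_iff_ne_zero.2 h0)))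
  obtain ⟨n, hn1, hn2⟩ := hev.exists
  exact absurd (key _ (by simp) hn2.le) (not_le.2 hn1)

/-- The lower bound with exponent 1, `a = u(E)` and `c = 2W(a)` gives `φ_I(a)/2`, and `|E| ≤
φ_I(a)`. Cancelling `W(a)` requires it to be nonzero, hence the finiteness of the integral. -/
theorem volume_le_of_hardy {u : ℝ → ℝ} (hu : LocallyIntegrable u volume)
    (hu_pos : ∀ᵐ x ∂volume, 0 < u x) {w : ℝ → ℝ} {I : Set ℝ} (hI : IsInterval I)
    (h0 : primitive w (weight u I) ≠ 0) (hfin : primitive w (weight u I) ≠ ∞) {q : ℝ} (hq : 1 < q)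
    (hH : ∫⁻ s in initialSegment (weight u I), hardyRatio u w I s ^ q ∂halfWeight w ≠ ∞)
    {E : Set ℝ} (hE : NullMeasurableSet E volume) (hEI : E ⊆ I)
    (hle : 2 * primitive w (weight u E) ≤ primitive w (weight u I)) :
    volume E ≤ 2 * ∫⁻ s in initialSegment (weight u I) ∩
      {s | primitive w (ENNReal.ofReal s) ≤ 2 * primitive w (weight u E)},
        hardyRatio u w I s ∂halfWeight w := by
  rcases eq_or_ne (volume E) 0 with hz | hz
  · simp [hz]
  have hE0 : weight u E ≠ 0 := fun h => hz (absolutelyContinuous_weight hu hu_pos h)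
  have hEt : weight u E ≠ ∞ := measure_ne_top_of_subset hEI (weight_ne_top hu hI.2.1)
  set a := (weight u E).toReal with ha_def
  have ha : 0 < a := ENNReal.toReal_pos hE0 hEt
  have haE : weight u E = ENNReal.ofReal a := (ENNReal.ofReal_toReal hEt).symm
  have haI : ENNReal.ofReal a ≤ weight u I := haE ▸ measure_mono hEI
  rw [haE] at hle ⊢
  have hWa := primitive_ne_zero_of_hardy hu hu_pos hI h0 hfin hq hH ha haI
  have hWt : primitive w (ENNReal.ofReal a) ≠ ∞ :=
    ne_top_of_le_ne_top hfin (primitive_mono w haI)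
  have h := hardyRatio_lower_bound hu hu_pos hI hfin zero_le_one ha hle
  simp only [ENNReal.rpow_one] at h
  refine le_trans ?_ (mul_le_mul_right h 2)
  have hphi : volume E ≤ phi u I a := le_sSup ⟨E, hE, hEI, by rw [wMeas_eq, haE], rfl⟩
  refine hphi.trans (le_of_eq ?_)
  have hsub : 2 * primitive w (ENNReal.ofReal a) - primitive w (ENNReal.ofReal a) =
      primitive w (ENNReal.ofReal a) := by rw [two_mul, ENNReal.add_sub_cancel_right hWt]
  rw [hsub, mul_left_comm, ENNReal.div_mul_cancel (mul_ne_zero two_ne_zero hWa)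
    (ENNReal.mul_ne_top ENNReal.ofNat_ne_top hWt)]

theorem setLIntegral_le_of_hardy {p q : ℝ} (hpq : p.HolderConjugate q) {u : ℝ → ℝ}
    (hu : LocallyIntegrable u volume) (hu_pos : ∀ᵐ x ∂volume, 0 < u x) {w : ℝ → ℝ}
    (hw : LocallyIntegrableOn w (Ioi 0) volume) {I : Set ℝ} (hI : IsInterval I)
    (h0 : primitive w (weight u I) ≠ 0) (hfin : primitive w (weight u I) ≠ ∞)
    (hH : ∫⁻ s in initialSegment (weight u I), hardyRatio u w I s ^ q ∂halfWeight w ≠ ∞)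
    {f : ℝ → ℝ} (hf : AEMeasurable f volume) :
    (∫⁻ x in I, ENNReal.ofReal |f x|) * primitive w (weight u I) ^ (1 / p) ≤
      2 * (geomConst 1 ^ p * (2 * geomConst p)) ^ (1 / p) * lorentzNorm p u w f *
        (2 * ((∫⁻ s in initialSegment (weight u I), hardyRatio u w I s ^ q ∂halfWeight w) ^ (1 / q)
          * primitive w (weight u I) ^ (1 / p)) + volume I) := by
  have hp : 0 < p := hpq.pos
  set W1 := primitive w (weight u I) with hW1
  set T := initialSegment (weight u I) with hT
  set m := halfWeight w with hm
  set N := lorentzNorm p u w f with hN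
  set A := (∫⁻ s in T, hardyRatio u w I s ^ q ∂m) ^ (1 / q) with hA
  set D : ℤ → Set ℝ := fun j => {x | (2 : ℝ≥0∞) ^ (j : ℝ) < ENNReal.ofReal |f x|} with hD
  set E : ℤ → Set ℝ := fun j => D j ∩ I with hE_def
  have hE : ∀ j, NullMeasurableSet (E j) volume := fun j =>
    (nullMeasurableSet_lt aemeasurable_const
      (measurable_norm.comp_aemeasurable hf).ennreal_ofReal).inter
      hI.measurableSet.nullMeasurableSet
  set c : ℤ → ℝ≥0∞ := fun j => 2 * primitive w (weight u (E j)) with hc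
  have hIt : weight u I = ENNReal.ofReal (weight u I).toReal :=
    (ENNReal.ofReal_toReal (weight_ne_top hu hI.2.1)).symm
  have hsum : ∑' j : ℤ, (2 : ℝ≥0∞) ^ ((j : ℝ) * p) * c j ≤ 2 * geomConst p * N ^ p := by
    calc _ ≤ ∑' j : ℤ, 2 * ((2 : ℝ≥0∞) ^ ((j : ℝ) * p) * primitive w (wMeas u (D j))) := by
          refine ENNReal.tsum_le_tsum fun j => ?_
          rw [hc, mul_left_comm, wMeas_eq]
          gcongr
          exact primitive_mono w (measure_mono inter_subset_left)
      _ ≤ _ := by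
          rw [ENNReal.tsum_mul_left, mul_assoc]
          gcongr
          exact tsum_two_rpow_mul_primitive_le hp u hw f
  -- The sum over the levels where `W` is at most half of its value at `u(I)`.
  set F : ℝ → ℝ≥0∞ := fun s => ∑' j : ℤ,
    {j : ℤ | primitive w (ENNReal.ofReal s) ≤ c j}.indicator (fun j => (2 : ℝ≥0∞) ^ (j : ℝ)) j
    with hF
  have hSm : ∀ j, MeasurableSet {s : ℝ | primitive w (ENNReal.ofReal s) ≤ c j} := fun j =>
    measurableSet_le (primitive_comp_ofReal_mono w).measurable measurable_const
  have hFm : Measurable F := by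
    refine Measurable.tsum fun j => ?_
    exact (measurable_const (a := (2 : ℝ≥0∞) ^ (j : ℝ))).indicator (hSm j)
  -- The power passes inside the geometric sum, and `{W ≤ c_j}` has `w`-mass at most `c_j`.
  have hFint : ∫⁻ s in T, F s ^ p ∂m ≤ geomConst 1 ^ p * (2 * geomConst p) * N ^ p := by
    calc _ ≤ ∫⁻ s in T, geomConst 1 ^ p * ∑' j : ℤ,
            {s : ℝ | primitive w (ENNReal.ofReal s) ≤ c j}.indicator
              (fun _ => (2 : ℝ≥0∞) ^ ((j : ℝ) * p)) s ∂m :=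
          lintegral_mono fun s => tsum_indicator_two_rpow_rpow_le hp _
      _ = geomConst 1 ^ p * ∑' j : ℤ, (2 : ℝ≥0∞) ^ ((j : ℝ) * p) *
            m ({s : ℝ | primitive w (ENNReal.ofReal s) ≤ c j} ∩ T) := by
          rw [lintegral_const_mul' _ _ (ENNReal.rpow_ne_top_of_nonneg hp.le
            (geomConst_ne_top one_pos)),
            lintegral_tsum fun j => (measurable_const.indicator (hSm j)).aemeasurable]
          congr 1
          refine tsum_congr fun j => ?_
          rw [lintegral_indicator_const (hSm j), Measure.restrict_apply (hSm j)]
      _ ≤ geomConst 1 ^ p * ∑' j : ℤ, (2 : ℝ≥0∞) ^ ((j : ℝ) * p) * c j := by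
          refine mul_le_mul_right (ENNReal.tsum_le_tsum fun j => mul_le_mul_right ?_ _) _
          rw [hT, hIt, initialSegment_ofReal, inter_comm]
          exact halfWeight_sublevel_le (hIt ▸ hfin) _
      _ ≤ _ := by
          rw [mul_assoc]
          gcongr
  set G := (geomConst 1 ^ p * (2 * geomConst p)) ^ (1 / p) with hG
  have hroot : (geomConst 1 ^ p * (2 * geomConst p) * N ^ p) ^ (1 / p) = G * N := by
    rw [ENNReal.mul_rpow_of_nonneg _ _ (by positivity), ← ENNReal.rpow_mul,
      mul_one_div_cancel hp.ne', ENNReal.rpow_one]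
  -- Exchanging sum and integral turns the left side into `∫ (φ_I/W) F dw`, to which Hölder applies.
  have hlow : ∑' j : ℤ, (2 : ℝ≥0∞) ^ (j : ℝ) *
      ∫⁻ s in T ∩ {s | primitive w (ENNReal.ofReal s) ≤ c j}, hardyRatio u w I s ∂m ≤
        A * (G * N) := by
    have hmeas := aemeasurable_hardyRatio hu hu_pos w hI m
    calc _ = ∫⁻ s in T, (hardyRatio u w I * F) s ∂m := by
          have h1 : ∀ s, (hardyRatio u w I * F) s = ∑' j : ℤ, hardyRatio u w I s *
              {s : ℝ | primitive w (ENNReal.ofReal s) ≤ c j}.indicator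
                (fun _ => (2 : ℝ≥0∞) ^ (j : ℝ)) s := fun s => by
            rw [ENNReal.tsum_mul_left]; rfl
          simp only [h1]
          rw [lintegral_tsum]
          swap
          · exact fun j => hmeas.mul (measurable_const.indicator (hSm j)).aemeasurable
          refine tsum_congr fun j => ?_
          rw [← lintegral_const_mul' _ _ (two_rpow_ne_top _), inter_comm,
            ← Measure.restrict_restrict (hSm j), ← lintegral_indicator (hSm j)]
          refine lintegral_congr fun s => ?_
          by_cases hs : s ∈ {s : ℝ | primitive w (ENNReal.ofReal s) ≤ c j}
          · rw [indicator_of_mem hs, indicator_of_mem hs, mul_comm]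
          · rw [indicator_of_notMem hs, indicator_of_notMem hs, mul_zero]
      _ ≤ A * (∫⁻ s in T, F s ^ p ∂m) ^ (1 / p) :=
          ENNReal.lintegral_mul_le_Lp_mul_Lq _ hpq.symm hmeas hFm.aemeasurable
      _ ≤ A * (G * N) := by
          rw [← hroot]
          gcongr
  -- The sum over the remaining levels.
  set R := {j : ℤ | W1 < c j} with hR
  have hhigh : (∑' j : ℤ, R.indicator (fun j => (2 : ℝ≥0∞) ^ (j : ℝ)) j) * W1 ^ (1 / p) ≤
      G * N := by
    rw [← hroot]
    refine (ENNReal.rpow_le_rpow_iff hp).1 ?_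
    rw [ENNReal.mul_rpow_of_nonneg _ _ hp.le, one_div, ENNReal.rpow_inv_rpow hp.ne',
      ENNReal.rpow_inv_rpow hp.ne']
    calc _ ≤ geomConst 1 ^ p * (∑' j : ℤ, R.indicator
            (fun j => (2 : ℝ≥0∞) ^ ((j : ℝ) * p)) j) * W1 := by
          gcongr
          exact tsum_indicator_two_rpow_rpow_le hp R
      _ ≤ geomConst 1 ^ p * ∑' j : ℤ, (2 : ℝ≥0∞) ^ ((j : ℝ) * p) * c j := by
          rw [mul_assoc, ← ENNReal.tsum_mul_right]
          refine mul_le_mul_right (ENNReal.tsum_le_tsum fun j => ?_) _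
          by_cases hj : j ∈ R
          · rw [indicator_of_mem hj]
            exact mul_le_mul_right (le_of_lt hj) _
          · rw [indicator_of_notMem hj, zero_mul]
            exact zero_le
      _ ≤ _ := by
          rw [mul_assoc]
          gcongr
  have hvol : ∀ j : ℤ, (2 : ℝ≥0∞) ^ (j : ℝ) * volume (E j) ≤
      2 * ((2 : ℝ≥0∞) ^ (j : ℝ) * ∫⁻ s in T ∩ {s | primitive w (ENNReal.ofReal s) ≤ c j},
        hardyRatio u w I s ∂m) + volume I * R.indicator (fun j => (2 : ℝ≥0∞) ^ (j : ℝ)) j :=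
    fun j => by
      by_cases hj : j ∈ R
      · rw [indicator_of_mem hj, mul_comm (volume I)]
        refine le_trans ?_ le_add_self
        gcongr
        exact inter_subset_right
      · refine le_trans ?_ le_self_add
        rw [mul_left_comm]
        gcongr
        exact volume_le_of_hardy hu hu_pos hI h0 hfin hpq.symm.lt hH (hE j) inter_subset_right
          (not_lt.1 hj)
  calc _ ≤ 2 * (∑' j : ℤ, (2 : ℝ≥0∞) ^ (j : ℝ) * volume (E j)) * W1 ^ (1 / p) := by
        gcongr
        exact setLIntegral_le_tsum hI.measurableSet hf
    _ ≤ 2 * (2 * (A * (G * N)) + volume I *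
          ∑' j : ℤ, R.indicator (fun j => (2 : ℝ≥0∞) ^ (j : ℝ)) j) * W1 ^ (1 / p) := by
        gcongr
        refine (ENNReal.tsum_le_tsum hvol).trans ?_
        rw [ENNReal.tsum_add, ENNReal.tsum_mul_left, ENNReal.tsum_mul_left]
        gcongr
    _ = 2 * (2 * (A * (G * N)) * W1 ^ (1 / p) + volume I *
          ((∑' j : ℤ, R.indicator (fun j => (2 : ℝ≥0∞) ^ (j : ℝ)) j) * W1 ^ (1 / p))) := by ring
    _ ≤ 2 * (2 * (A * (G * N)) * W1 ^ (1 / p) + volume I * (G * N)) := by gcongr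
    _ = _ := by ring

theorem hardy_integral_eq {w : ℝ → ℝ} (hw : LocallyIntegrableOn w (Ioi 0) volume) (u : ℝ → ℝ)
    (I : Set ℝ) (q : ℝ) :
    ∫⁻ t in initialSegment (wMeas u I),
        (phi u I t / primitive w (ENNReal.ofReal t)) ^ q * ENNReal.ofReal (w t) =
      ∫⁻ t in initialSegment (weight u I), hardyRatio u w I t ^ q ∂halfWeight w := by
  rw [setLIntegral_initialSegment hw, wMeas_eq]
  rfl

/-- If `W` is infinite, the elements of the Lorentz space vanish almost everywhere. -/
theorem setLIntegral_eq_zero_of_primitive_eq_top {p : ℝ} (hp : 0 < p) {u : ℝ → ℝ}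
    (hu : LocallyIntegrable u volume) (hu_pos : ∀ᵐ x ∂volume, 0 < u x) {w : ℝ → ℝ}
    (hw : LocallyIntegrableOn w (Ioi 0) volume) {I : Set ℝ} (hI : IsInterval I)
    (htop : primitive w (weight u I) = ∞) {f : ℝ → ℝ} (hf : f ∈ lorentzSpace p u w) :
    ∫⁻ x in I, ENNReal.ofReal |f x| = 0 := by
  refine le_antisymm ((setLIntegral_le_tsum hI.measurableSet hf.1).trans_eq ?_) zero_le
  simp only [mul_eq_zero, ENNReal.tsum_eq_zero]
  refine Or.inr fun j => Or.inr (measure_mono_null inter_subset_left ?_)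
  set D := {x | (2 : ℝ≥0∞) ^ (j : ℝ) < ENNReal.ofReal |f x|} with hD
  have h1 := (ENNReal.le_tsum j).trans (tsum_two_rpow_mul_primitive_le hp u hw f)
  have h2 : geomConst p * lorentzNorm p u w f ^ p ≠ ∞ := ENNReal.mul_ne_top (geomConst_ne_top hp)
    (ENNReal.rpow_ne_top_of_nonneg hp.le hf.2.ne)
  by_contra h0
  have hD0 : wMeas u D ≠ 0 := by
    rw [wMeas_eq]
    exact fun h => h0 (absolutelyContinuous_weight hu hu_pos h)
  have hDt := primitive_eq_top hw (weight_ne_top hu hI.2.1) htop hD0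
  rw [← hD, hDt, ENNReal.mul_top (two_rpow_pos _).ne', top_le_iff] at h1
  exact h2 h1

theorem dualityCondition_of_hardyCondition {p : ℝ} (hp : 1 < p) {u : ℝ → ℝ}
    (hu : LocallyIntegrable u volume) (hu_pos : ∀ᵐ x ∂volume, 0 < u x) {w : ℝ → ℝ}
    (hw : LocallyIntegrableOn w (Ioi 0) volume) (h : HardyCondition p u w) :
    DualityCondition p u w := by
  obtain ⟨C, -, h⟩ := h
  have hp0 : 0 < p := zero_lt_one.trans hp
  have hpq : p.HolderConjugate (p / (p - 1)) := Real.HolderConjugate.conjExponent hp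
  set q := p / (p - 1) with hq
  have hq0 : 0 < q := hpq.symm.pos
  set G := (geomConst 1 ^ p * (2 * geomConst p)) ^ (1 / p) with hG
  have hGt : G ≠ ∞ := ENNReal.rpow_ne_top_of_nonneg (by positivity) (ENNReal.mul_ne_top
    (ENNReal.rpow_ne_top_of_nonneg hp0.le (geomConst_ne_top one_pos))
    (ENNReal.mul_ne_top ENNReal.ofNat_ne_top (geomConst_ne_top hp0)))
  refine dualityCondition_of_le hp0 hw hu_pos (D := 2 * G * (2 * C + 1)) ?_ ?_
  · exact ENNReal.mul_ne_top (ENNReal.mul_ne_top ENNReal.ofNat_ne_top hGt) (ENNReal.add_ne_top.2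
      ⟨ENNReal.mul_ne_top ENNReal.ofNat_ne_top ENNReal.coe_ne_top, ENNReal.one_ne_top⟩)
  intro I hI f hf
  rw [wMeas_eq]
  rcases eq_or_ne (primitive w (weight u I)) 0 with h0 | h0
  · rw [h0, ENNReal.zero_rpow_of_pos (by positivity), mul_zero]
    exact zero_le
  -- Here `‖χ_I‖ = ∞`, and the product is `0 · ∞ = 0`.
  rcases eq_or_ne (primitive w (weight u I)) ∞ with ht | ht
  · rw [setLIntegral_eq_zero_of_primitive_eq_top hp0 hu hu_pos hw hI ht hf, zero_mul]
    exact zero_le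
  have hV0 : primitive w (weight u I) ^ (1 / p) ≠ 0 :=
    (ENNReal.rpow_pos (pos_iff_ne_zero.2 h0) ht).ne'
  have hVt : primitive w (weight u I) ^ (1 / p) ≠ ∞ :=
    ENNReal.rpow_ne_top_of_nonneg (by positivity) ht
  have hI' := h I hI
  rw [hardy_integral_eq hw, wMeas_eq] at hI'
  have hH : ∫⁻ s in initialSegment (weight u I), hardyRatio u w I s ^ q ∂halfWeight w ≠ ∞ := by
    intro hH
    rw [hH, ENNReal.top_rpow_of_pos (by positivity), top_le_iff] at hI'
    exact ENNReal.mul_ne_top ENNReal.coe_ne_top (ENNReal.div_ne_top hI.volume_ne_top hV0) hI'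
  refine (setLIntegral_le_of_hardy hpq hu hu_pos hw hI h0 ht hH hf.1).trans ?_
  have hAV := mul_le_mul_left hI' (primitive w (weight u I) ^ (1 / p))
  rw [mul_assoc, ENNReal.div_mul_cancel hV0 hVt] at hAV
  calc _ ≤ 2 * G * lorentzNorm p u w f * (2 * (C * volume I) + volume I) := by gcongr
    _ = _ := by ring

/-! ### The case `p > 1`: necessity of the integral condition -/

/-- If `B` is the weighted sum, each `c i` is at most `B^{1/p} 2^{-(K-i)/(2p)}`, and these bounds
sum geometrically. The growth rate `1/2` is below 1, so that the factor `2^{-k}` still wins in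
`sum_range_sum_range_le`. -/
theorem sum_range_rpow_le {p : ℝ} (hp : 0 < p) (c : ℕ → ℝ≥0∞) (K : ℕ) :
    (∑ i ∈ Finset.range (K + 1), c i) ^ p ≤ geomConst (1 / (2 * p)) ^ p *
      ∑ i ∈ Finset.range (K + 1), c i ^ p * (2 : ℝ≥0∞) ^ (((K - i : ℕ) : ℝ) / 2) := by
  set B := ∑ i ∈ Finset.range (K + 1), c i ^ p * (2 : ℝ≥0∞) ^ (((K - i : ℕ) : ℝ) / 2) with hB
  have hle : ∀ i ∈ Finset.range (K + 1),
      c i ≤ B ^ p⁻¹ * ((2 : ℝ≥0∞) ^ (-(1 / (2 * p)))) ^ (K - i) := fun i hi => by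
    have h1 : c i ^ p * (2 : ℝ≥0∞) ^ (((K - i : ℕ) : ℝ) / 2) ≤ B :=
      Finset.single_le_sum (f := fun i => c i ^ p * (2 : ℝ≥0∞) ^ (((K - i : ℕ) : ℝ) / 2))
        (fun _ _ => zero_le) hi
    have h2 := ENNReal.rpow_le_rpow h1 (inv_nonneg.2 hp.le)
    rw [ENNReal.mul_rpow_of_nonneg _ _ (inv_nonneg.2 hp.le), ENNReal.rpow_rpow_inv hp.ne',
      ← ENNReal.rpow_mul] at h2
    refine le_trans (le_of_eq ?_) (mul_le_mul_left h2 _)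
    rw [mul_assoc, ← ENNReal.rpow_natCast, ← ENNReal.rpow_mul, ← two_rpow_add]
    have : ((K - i : ℕ) : ℝ) / 2 * p⁻¹ + -(1 / (2 * p)) * ((K - i : ℕ) : ℝ) = 0 := by
      field_simp
      ring
    rw [this, ENNReal.rpow_zero, mul_one]
  calc _ ≤ (B ^ p⁻¹ * geomConst (1 / (2 * p))) ^ p := by
        gcongr
        refine (Finset.sum_le_sum hle).trans ?_
        rw [← Finset.mul_sum]
        gcongr
        have := Finset.sum_range_reflect
          (fun i => ((2 : ℝ≥0∞) ^ (-(1 / (2 * p)))) ^ i) (K + 1)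
        simp only [Nat.add_sub_cancel] at this
        rw [this]
        exact ENNReal.sum_le_tsum _
    _ = _ := by
        rw [ENNReal.mul_rpow_of_nonneg _ _ hp.le, ENNReal.rpow_inv_rpow hp.ne', mul_comm]

/-- Exchange the sums and use `2^{(k-i)/2} 2^{-k} = 2^{-i} 2^{-(k-i)/2}`. -/
theorem sum_range_sum_range_le (a : ℕ → ℝ≥0∞) (W₁ : ℝ≥0∞) (N : ℕ) :
    ∑ k ∈ Finset.range N, (∑ i ∈ Finset.range (k + 1), a i *
        (2 : ℝ≥0∞) ^ (((k - i : ℕ) : ℝ) / 2)) * (W₁ * (2⁻¹) ^ k) ≤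
      geomConst (1 / 2) * ∑ i ∈ Finset.range N, a i * (W₁ * (2⁻¹) ^ i) := by
  have hterm : ∀ k, ∀ i ∈ Finset.range (k + 1),
      a i * (2 : ℝ≥0∞) ^ (((k - i : ℕ) : ℝ) / 2) * (W₁ * (2⁻¹) ^ k) =
        a i * (W₁ * (2⁻¹) ^ i) * ((2 : ℝ≥0∞) ^ (-(1 / 2 : ℝ))) ^ (k - i) := fun k i hi => by
    have hik : k = i + (k - i) := by have := Finset.mem_range.1 hi; omega
    have h2 : (2 : ℝ≥0∞) ^ (((k - i : ℕ) : ℝ) / 2) * (2⁻¹) ^ (k - i) =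
        ((2 : ℝ≥0∞) ^ (-(1 / 2 : ℝ))) ^ (k - i) := by
      rw [← ENNReal.rpow_neg_one, ← ENNReal.rpow_natCast, ← ENNReal.rpow_natCast,
        ← ENNReal.rpow_mul, ← ENNReal.rpow_mul, ← two_rpow_add]
      congr 1
      ring
    rw [← h2]
    conv_lhs => rw [show (2⁻¹ : ℝ≥0∞) ^ k = 2⁻¹ ^ i * 2⁻¹ ^ (k - i) by rw [← pow_add, ← hik]]
    ring
  calc _ = ∑ k ∈ Finset.range N, ∑ i ∈ Finset.range (k + 1),
          a i * (W₁ * (2⁻¹) ^ i) * ((2 : ℝ≥0∞) ^ (-(1 / 2 : ℝ))) ^ (k - i) := by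
        refine Finset.sum_congr rfl fun k _ => ?_
        rw [Finset.sum_mul]
        exact Finset.sum_congr rfl (hterm k)
    _ = ∑ i ∈ Finset.range N, ∑ k ∈ Finset.Ico i N,
          a i * (W₁ * (2⁻¹) ^ i) * ((2 : ℝ≥0∞) ^ (-(1 / 2 : ℝ))) ^ (k - i) := by
        refine Finset.sum_comm' fun k i => ?_
        simp only [Finset.mem_range, Finset.mem_Ico]
        omega
    _ ≤ _ := by
        rw [Finset.mul_sum]
        refine Finset.sum_le_sum fun i _ => ?_
        rw [← Finset.mul_sum, mul_comm, Finset.sum_Ico_eq_sum_range]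
        gcongr
        simp only [Nat.add_sub_cancel_left]
        exact ENNReal.sum_le_tsum _

/-- The step function `∑_{k < N} c_k χ_{E_k}`. -/
def stepFun (E : ℕ → Set ℝ) (c : ℕ → ℝ≥0∞) (N : ℕ) (x : ℝ) : ℝ≥0∞ :=
  ∑ k ∈ Finset.range N, (E k).indicator (fun _ => c k) x

theorem stepFun_ne_top {E : ℕ → Set ℝ} {c : ℕ → ℝ≥0∞} (hc : ∀ k, c k ≠ ∞) (N : ℕ) (x : ℝ) :
    stepFun E c N x ≠ ∞ := by
  refine ENNReal.sum_ne_top.2 fun k _ => ?_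
  by_cases hx : x ∈ E k <;> simp [hx, hc k]

theorem ofReal_stepFun {E : ℕ → Set ℝ} {c : ℕ → ℝ≥0∞} (hc : ∀ k, c k ≠ ∞) (N : ℕ) (x : ℝ) :
    ENNReal.ofReal (stepFun E c N x).toReal = stepFun E c N x :=
  ENNReal.ofReal_toReal (stepFun_ne_top hc N x)

/-- Let `k₀` be the first index with `u(E_{k₀}) ≤ s`. By nesting, outside `E_{k₀}` only terms with
`u(E_k) > s` are present, so the step function exceeds their sum only inside `E_{k₀}`. -/
theorem rearrangement_stepFun_le {u : ℝ → ℝ} {E : ℕ → Set ℝ} (hE : Antitone E) {c : ℕ → ℝ≥0∞}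
    (hc : ∀ k, c k ≠ ∞) (N : ℕ) (s : ℝ) :
    rearrangement u (fun x => (stepFun E c N x).toReal) s ≤
      ∑ k ∈ Finset.range N with ENNReal.ofReal s < weight u (E k), c k := by
  classical
  refine rearrangement_le ?_
  simp only [abs_of_nonneg ENNReal.toReal_nonneg, ofReal_stepFun hc, wMeas_eq]
  by_cases h : ∃ k, weight u (E k) ≤ ENNReal.ofReal s
  · refine (measure_mono fun x hx => ?_).trans (Nat.find_spec h)
    by_contra hxE
    refine absurd (show _ < stepFun E c N x from hx) (not_lt.2 ?_)
    rw [stepFun, Finset.sum_filter]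
    refine Finset.sum_le_sum fun k _ => ?_
    split_ifs with hk
    · exact indicator_le_self _ _ _
    · rw [indicator_of_notMem]
      exact fun hxk => hxE (hE (Nat.find_min' h (not_lt.1 hk)) hxk)
  · push Not at h
    have : {x | ∑ k ∈ Finset.range N with ENNReal.ofReal s < weight u (E k), c k <
        stepFun E c N x} = ∅ := by
      refine eq_empty_of_forall_notMem fun x hx =>
        absurd (show _ < stepFun E c N x from hx) (not_lt.2 ?_)
      rw [Finset.filter_true_of_mem fun k _ => h k]
      exact Finset.sum_le_sum fun k _ => indicator_le_self _ _ _
    rw [this, measure_empty]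
    exact zero_le

theorem lorentzNorm_stepFun_rpow_le {p : ℝ} (hp : 0 < p) {u w : ℝ → ℝ}
    (hw : LocallyIntegrableOn w (Ioi 0) volume) {E : ℕ → Set ℝ} (hE : Antitone E)
    {c : ℕ → ℝ≥0∞} (hc : ∀ k, c k ≠ ∞) {W₁ : ℝ≥0∞}
    (hW : ∀ k, primitive w (weight u (E k)) = W₁ * (2⁻¹) ^ k) (N : ℕ) :
    lorentzNorm p u w (fun x => (stepFun E c N x).toReal) ^ p ≤
      geomConst (1 / (2 * p)) ^ p * geomConst (1 / 2) *
        ∑ k ∈ Finset.range N, c k ^ p * (W₁ * (2⁻¹) ^ k) := by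
  set L := geomConst (1 / (2 * p)) ^ p with hL
  have hLt : L ≠ ∞ := ENNReal.rpow_ne_top_of_nonneg hp.le (geomConst_ne_top (by positivity))
  set B : ℕ → ℝ≥0∞ := fun k =>
    ∑ i ∈ Finset.range (k + 1), c i ^ p * (2 : ℝ≥0∞) ^ (((k - i : ℕ) : ℝ) / 2) with hB
  have hpt : ∀ s ∈ Ioi (0 : ℝ), rearrangement u (fun x => (stepFun E c N x).toReal) s ^ p ≤
      L * ∑ k ∈ Finset.range N, (initialSegment (weight u (E k))).indicator (fun _ => B k) s := by
    intro s hs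
    refine (ENNReal.rpow_le_rpow (rearrangement_stepFun_le hE hc N s) hp.le).trans ?_
    set Q := {k ∈ Finset.range N | ENNReal.ofReal s < weight u (E k)} with hQ
    rcases Q.eq_empty_or_nonempty with h0 | hne
    · rw [h0, Finset.sum_empty, ENNReal.zero_rpow_of_pos hp]
      exact zero_le
    -- All indices of `Q` are at most `K`, and the single term `k = K` on the right suffices.
    set K := Q.max' hne with hK
    have hKQ : K ∈ Q := Q.max'_mem hne
    have hKm := Finset.mem_filter.1 hKQ
    calc _ ≤ (∑ i ∈ Finset.range (K + 1), c i) ^ p := by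
          gcongr
          exact fun k hk => Finset.mem_range.2 (Nat.lt_succ_of_le (Q.le_max' k hk))
      _ ≤ L * B K := sum_range_rpow_le hp c K
      _ ≤ _ := by
          gcongr
          have h1 := Finset.single_le_sum
            (f := fun k => (initialSegment (weight u (E k))).indicator (fun _ => B k) s)
            (fun _ _ => zero_le) hKm.1
          have h2 : s ∈ initialSegment (weight u (E K)) := ⟨hs, hKm.2⟩
          simpa only [indicator_of_mem h2] using h1
  rw [lorentzNorm_rpow hp u hw]
  refine (lintegral_mono_ae ((ae_mem_Ioi_halfWeight w).mono hpt)).trans ?_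
  rw [lintegral_const_mul' _ _ hLt, mul_assoc, lintegral_finsetSum _ fun k _ =>
    measurable_const.indicator (measurableSet_initialSegment _)]
  gcongr
  refine le_trans (le_of_eq ?_) (sum_range_sum_range_le (fun i => c i ^ p) W₁ N)
  refine Finset.sum_congr rfl fun k _ => ?_
  rw [lintegral_indicator_const (measurableSet_initialSegment _), ← primitive_eq, hW]

theorem setLIntegral_stepFun {I : Set ℝ} (hI : MeasurableSet I) {E : ℕ → Set ℝ}
    (hE : ∀ k, NullMeasurableSet (E k) volume) (hEI : ∀ k, E k ⊆ I) (c : ℕ → ℝ≥0∞) (N : ℕ) :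
    ∫⁻ x in I, stepFun E c N x = ∑ k ∈ Finset.range N, c k * volume (E k) := by
  simp only [stepFun]
  have hm : ∀ k, NullMeasurableSet (E k) (volume.restrict I) := fun k =>
    (hE k).mono_ac Measure.absolutelyContinuous_restrict
  rw [lintegral_finsetSum' _ fun k _ => aemeasurable_const.indicator₀ (hm k)]
  refine Finset.sum_congr rfl fun k _ => ?_
  rw [lintegral_indicator_const₀ (hm k), Measure.restrict_apply' hI, inter_eq_left.2 (hEI k)]

theorem aemeasurable_stepFun {E : ℕ → Set ℝ} (hE : ∀ k, NullMeasurableSet (E k) volume)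
    (c : ℕ → ℝ≥0∞) (N : ℕ) : AEMeasurable (stepFun E c N) volume :=
  Finset.aemeasurable_fun_sum _ fun k _ => aemeasurable_const.indicator₀ (hE k)

/-- Otherwise an extremal set of weight `a` has positive measure and an indicator of norm 0, which
makes the associate norm infinite. -/
theorem primitive_ne_zero_of_associateNorm {p : ℝ} (hp : 0 < p) {u : ℝ → ℝ}
    (hu : LocallyIntegrable u volume) (hu_pos : ∀ᵐ x ∂volume, 0 < u x) {w : ℝ → ℝ}
    (hw : LocallyIntegrableOn w (Ioi 0) volume) {I : Set ℝ} (hI : IsInterval I)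
    (hfin : associateNorm p u w (I.indicator fun x => (u x)⁻¹) ≠ ∞) {a : ℝ} (ha : 0 < a)
    (haI : ENNReal.ofReal a ≤ weight u I) : primitive w (ENNReal.ofReal a) ≠ 0 := by
  intro hz
  obtain ⟨E, hE, -⟩ := exists_extremal_family hu hu_pos hI
  obtain ⟨h1, h2, h3, h4⟩ := hE a ha haI
  have h := volume_div_le_associateNorm hp hw hu_pos hI.measurableSet h1 h2
    (by rw [wMeas_eq, h3, hz]; exact ENNReal.zero_ne_top)
  rw [wMeas_eq, h3, hz, ENNReal.zero_rpow_of_pos (by positivity), ENNReal.div_zero, top_le_iff] at h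
  · exact hfin h
  · rw [h4]
    exact (phi_pos hu hu_pos hI ha haI).ne'

/-- Points at which `W` takes the values `2 ^ (-k) W(T)`. -/
theorem exists_primitive_eq_geometric {w : ℝ → ℝ} {T : ℝ} (hT : 0 < T)
    (hfin : primitive w (ENNReal.ofReal T) ≠ ∞)
    (hpos : ∀ a, 0 < a → a ≤ T → primitive w (ENNReal.ofReal a) ≠ 0) :
    ∃ t : ℕ → ℝ, t 0 = T ∧ Antitone t ∧ (∀ k, 0 < t k ∧ t k ≤ T) ∧
      ∀ k, primitive w (ENNReal.ofReal (t k)) = primitive w (ENNReal.ofReal T) * (2⁻¹) ^ k := by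
  set W₁ := primitive w (ENNReal.ofReal T) with hW₁
  have hW0 : W₁ ≠ 0 := hpos T hT le_rfl
  -- `W` may be constant just below `T`, so `t 0 = T` has to be imposed.
  have hex : ∀ k : ℕ, ∃ s, 0 ≤ s ∧ s ≤ T ∧ primitive w (ENNReal.ofReal s) = W₁ * (2⁻¹) ^ k ∧
      (k = 0 → s = T) := fun k => by
    rcases eq_or_ne k 0 with rfl | hk
    · exact ⟨T, hT.le, le_rfl, by simp [hW₁], fun _ => rfl⟩
    · obtain ⟨s, h1, h2, h3⟩ := exists_primitive_eq (c := W₁ * (2⁻¹) ^ k) hT.le hfin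
        (mul_le_of_le_one_right zero_le (pow_le_one₀ zero_le (by simp)))
      exact ⟨s, h1, h2, h3, fun h => absurd h hk⟩
  choose t ht0 htT ht hk using hex
  refine ⟨t, hk 0 rfl, antitone_nat_of_succ_le fun k => ?_, fun k => ⟨?_, htT k⟩, ht⟩
  · refine le_of_lt ((primitive_comp_ofReal_mono w).reflect_lt ?_)
    simp only [ht]
    rw [pow_succ, ← mul_assoc, ← div_eq_mul_inv]
    exact ENNReal.half_lt_self (mul_ne_zero hW0 (by simp))
      (ENNReal.mul_ne_top hfin (ENNReal.pow_ne_top (by simp)))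
  · refine (ht0 k).lt_of_ne fun h => ?_
    have := ht k
    rw [← h, ENNReal.ofReal_zero, primitive_zero] at this
    exact mul_ne_zero hW0 (by simp) this.symm

/-- On `[t_{k+1}, t_k)` one has `φ_I ≤ φ_I(t_k)` and `W ≥ W(t_k)/2`, whence the factor `2^q`. These
intervals cover since `W > 0` on `(0, u(I)]`. Enlarging them to `(0, t_k)` makes the mass exactly
`W(t_k)`. -/
theorem hardyRatio_integral_le_tsum {u : ℝ → ℝ} (hu : LocallyIntegrable u volume)
    (hu_pos : ∀ᵐ x ∂volume, 0 < u x) {w : ℝ → ℝ} {I : Set ℝ} (hI : IsInterval I) {q : ℝ}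
    (hq : 0 < q) {W₁ : ℝ≥0∞} (hWt : W₁ ≠ ∞) {t : ℕ → ℝ}
    (ht0 : ENNReal.ofReal (t 0) = weight u I) (hanti : Antitone t) (htpos : ∀ k, 0 < t k)
    (ht : ∀ k, primitive w (ENNReal.ofReal (t k)) = W₁ * (2⁻¹) ^ k)
    (hpos : ∀ a, 0 < a → ENNReal.ofReal a ≤ weight u I → primitive w (ENNReal.ofReal a) ≠ 0) :
    ∫⁻ s in initialSegment (weight u I), hardyRatio u w I s ^ q ∂halfWeight w ≤
      2 ^ q * ∑' k, (phi u I (t k) / (W₁ * (2⁻¹) ^ k)) ^ q * (W₁ * (2⁻¹) ^ k) := by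
  have htI : ∀ k, ENNReal.ofReal (t k) ≤ weight u I := fun k =>
    ht0 ▸ ENNReal.ofReal_le_ofReal (hanti (Nat.zero_le k))
  set r : ℕ → ℝ≥0∞ := fun k => phi u I (t k) / (W₁ * (2⁻¹) ^ k) with hr
  have hlim : Tendsto (fun k : ℕ => W₁ * (2⁻¹ : ℝ≥0∞) ^ k) atTop (𝓝 0) := by
    have := ENNReal.Tendsto.const_mul (a := W₁)
      (ENNReal.tendsto_pow_atTop_nhds_zero_of_lt_one (r := 2⁻¹) (by simp)) (Or.inr hWt)
    simpa using this
  have hpt : ∀ s ∈ initialSegment (weight u I), hardyRatio u w I s ^ q ≤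
      ∑' k, (Ioo 0 (t k)).indicator (fun _ => (2 * r k) ^ q) s := by
    intro s hs
    have hex : ∃ k, t (k + 1) ≤ s := by
      have hW := pos_iff_ne_zero.2 (hpos s hs.1 hs.2.le)
      obtain ⟨k, hk⟩ := ((hlim.comp (tendsto_add_atTop_nat 1)).eventually (gt_mem_nhds hW)).exists
      refine ⟨k, le_of_lt ((primitive_comp_ofReal_mono w).reflect_lt ?_)⟩
      simpa only [ht, Function.comp_apply] using hk
    classical
    set k := Nat.find hex with hk
    have hk1 : t (k + 1) ≤ s := Nat.find_spec hex
    have hk2 : s < t k := by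
      rcases Nat.eq_zero_or_pos k with h0 | h0
      · rw [h0]
        have := hs.2
        rw [← ht0] at this
        exact (ENNReal.ofReal_lt_ofReal_iff (htpos 0)).1 this
      · have := Nat.find_min hex (Nat.sub_lt h0 one_pos)
        rw [← hk, show k - 1 + 1 = k by omega] at this
        exact not_le.1 this
    refine le_trans ?_ (ENNReal.le_tsum k)
    rw [indicator_of_mem (show s ∈ Ioo 0 (t k) from ⟨hs.1, hk2⟩)]
    refine ENNReal.rpow_le_rpow ?_ hq.le
    calc hardyRatio u w I s ≤ phi u I (t k) / (W₁ * (2⁻¹) ^ (k + 1)) := by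
          refine ENNReal.div_le_div (phi_mono hu hu_pos hI hs.1 hk2.le (htI k)) ?_
          rw [← ht]
          exact primitive_comp_ofReal_mono w hk1
      _ = 2 * r k := by
          rw [hr, pow_succ, ← mul_assoc, div_eq_mul_inv, ENNReal.mul_inv (Or.inr (by simp))
            (Or.inr (by simp)), inv_inv, ← mul_assoc, mul_comm]
          rfl
  calc _ ≤ ∫⁻ s, ∑' k, (Ioo 0 (t k)).indicator (fun _ => (2 * r k) ^ q) s ∂halfWeight w :=
        (setLIntegral_mono' (measurableSet_initialSegment _) hpt).trans
          (setLIntegral_le_lintegral _ _)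
    _ = ∑' k, (2 * r k) ^ q * (W₁ * (2⁻¹) ^ k) := by
        rw [lintegral_tsum fun k => (measurable_const.indicator measurableSet_Ioo).aemeasurable]
        refine tsum_congr fun k => ?_
        rw [lintegral_indicator_const measurableSet_Ioo, ← primitive_ofReal, ht]
    _ = _ := by
        rw [← ENNReal.tsum_mul_left]
        refine tsum_congr fun k => ?_
        rw [ENNReal.mul_rpow_of_nonneg _ _ hq.le, mul_assoc]

/-- The coefficients `r_k^{q-1}` are extremal for `ℓ^p`–`ℓ^q` duality: as `(q-1)p = q`, the integral
of the test function is the sum `S` and its norm is at most `(K S)^{1/p}`. Truncation at `N` keeps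
`S` finite, so that `S^{1/p}` can be cancelled. -/
theorem sum_phi_le_associateNorm {p q : ℝ} (hpq : p.HolderConjugate q) {u : ℝ → ℝ}
    (hu : LocallyIntegrable u volume) (hu_pos : ∀ᵐ x ∂volume, 0 < u x) {w : ℝ → ℝ}
    (hw : LocallyIntegrableOn w (Ioi 0) volume) {I : Set ℝ} (hI : IsInterval I) {W₁ : ℝ≥0∞}
    (hW0 : W₁ ≠ 0) (hWt : W₁ ≠ ∞) {t : ℕ → ℝ} (hanti : Antitone t) (htpos : ∀ k, 0 < t k)
    (htI : ∀ k, ENNReal.ofReal (t k) ≤ weight u I)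
    (ht : ∀ k, primitive w (ENNReal.ofReal (t k)) = W₁ * (2⁻¹) ^ k) (N : ℕ) :
    (∑ k ∈ Finset.range N, (phi u I (t k) / (W₁ * (2⁻¹) ^ k)) ^ q * (W₁ * (2⁻¹) ^ k)) ^ (1 / q) ≤
      (geomConst (1 / (2 * p)) ^ p * geomConst (1 / 2)) ^ (1 / p) *
        associateNorm p u w (I.indicator fun x => (u x)⁻¹) := by
  have hp : 0 < p := hpq.pos
  have hq1 : 0 < q - 1 := by linarith [hpq.symm.lt]
  obtain ⟨F, hF, hFmono⟩ := exists_extremal_family hu hu_pos hI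
  set E : ℕ → Set ℝ := fun k => F (t k) with hE
  have hEk := fun k => hF (t k) (htpos k) (htI k)
  have hEanti : Antitone E := fun i j hij => hFmono _ _ (htpos j) (hanti hij) (htI i)
  set V : ℕ → ℝ≥0∞ := fun k => W₁ * (2⁻¹) ^ k with hV
  have hV0 : ∀ k, V k ≠ 0 := fun k => mul_ne_zero hW0 (by simp)
  have hVt : ∀ k, V k ≠ ∞ := fun k => ENNReal.mul_ne_top hWt (ENNReal.pow_ne_top (by simp))
  set r : ℕ → ℝ≥0∞ := fun k => phi u I (t k) / V k with hr
  have hrt : ∀ k, r k ≠ ∞ := fun k =>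
    ENNReal.div_ne_top (ne_top_of_le_ne_top hI.volume_ne_top (phi_le_volume u I _)) (hV0 k)
  have hr0 : ∀ k, r k ≠ 0 := fun k => (ENNReal.div_pos
    (phi_pos hu hu_pos hI (htpos k) (htI k)).ne' (hVt k)).ne'
  set c : ℕ → ℝ≥0∞ := fun k => r k ^ (q - 1) with hc
  have hct : ∀ k, c k ≠ ∞ := fun k => ENNReal.rpow_ne_top_of_nonneg hq1.le (hrt k)
  set S := ∑ k ∈ Finset.range N, r k ^ q * V k with hS
  have hSt : S ≠ ∞ := ENNReal.sum_ne_top.2 fun k _ =>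
    ENNReal.mul_ne_top (ENNReal.rpow_ne_top_of_nonneg (by linarith) (hrt k)) (hVt k)
  set K := geomConst (1 / (2 * p)) ^ p * geomConst (1 / 2) with hK
  have hKt : K ≠ ∞ := ENNReal.mul_ne_top
    (ENNReal.rpow_ne_top_of_nonneg hp.le (geomConst_ne_top (by positivity)))
    (geomConst_ne_top (by positivity))
  have hnorm : lorentzNorm p u w (fun x => (stepFun E c N x).toReal) ≤ (K * S) ^ (1 / p) := by
    rw [one_div, ENNReal.le_rpow_inv_iff hp]
    refine (lorentzNorm_stepFun_rpow_le hp hw hEanti hct (W₁ := W₁)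
      (fun k => by rw [(hEk k).2.2.1, ht]) N).trans (le_of_eq ?_)
    congr 1
    refine Finset.sum_congr rfl fun k _ => ?_
    rw [hc, ← ENNReal.rpow_mul]
    congr 2
    rw [hpq.symm.sub_one_mul_conj]
  have hint : ∫⁻ x in I, ENNReal.ofReal (stepFun E c N x).toReal = S := by
    simp only [ofReal_stepFun hct]
    rw [setLIntegral_stepFun hI.measurableSet (fun k => (hEk k).1) (fun k => (hEk k).2.1)]
    refine Finset.sum_congr rfl fun k _ => ?_
    have h1 : r k * V k = volume (E k) := by
      rw [(hEk k).2.2.2]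
      exact ENNReal.div_mul_cancel (hV0 k) (hVt k)
    have h2 : r k ^ q = r k ^ (q - 1) * r k := by
      conv_lhs => rw [show q = q - 1 + 1 by ring, ENNReal.rpow_add _ _ (hr0 k) (hrt k),
        ENNReal.rpow_one]
    rw [h2, mul_assoc, h1]
  have hmem : (fun x => (stepFun E c N x).toReal) ∈ lorentzSpace p u w :=
    ⟨(aemeasurable_stepFun (fun k => (hEk k).1) c N).ennreal_toReal, hnorm.trans_lt
      (ENNReal.rpow_lt_top_of_nonneg (by positivity) (ENNReal.mul_ne_top hKt hSt))⟩
  have h := setLIntegral_div_le_associateNorm hu_pos hI.measurableSet hmem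
    (fun x => ENNReal.toReal_nonneg)
  rw [hint] at h
  have h' := (ENNReal.div_le_div_left hnorm S).trans h
  rcases eq_or_ne S 0 with hS0 | hS0
  · rw [hS0, ENNReal.zero_rpow_of_pos (by have := hpq.symm.pos; positivity)]
    exact zero_le
  have hK0 : K ≠ 0 := mul_ne_zero (ENNReal.rpow_pos (zero_lt_one.trans_le (one_le_geomConst _))
    (geomConst_ne_top (by positivity))).ne' (zero_lt_one.trans_le (one_le_geomConst _)).ne'
  have hKS0 : (K * S) ^ (1 / p) ≠ 0 := (ENNReal.rpow_pos
    (pos_iff_ne_zero.2 (mul_ne_zero hK0 hS0)) (ENNReal.mul_ne_top hKt hSt)).ne'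
  have hKSt : (K * S) ^ (1 / p) ≠ ∞ :=
    ENNReal.rpow_ne_top_of_nonneg (by positivity) (ENNReal.mul_ne_top hKt hSt)
  rw [ENNReal.div_le_iff hKS0 hKSt, ENNReal.mul_rpow_of_nonneg _ _ (by positivity)] at h'
  have hsplit : S = S ^ (1 / q) * S ^ (1 / p) := by
    rw [← ENNReal.rpow_add _ _ hS0 hSt, add_comm, one_div, one_div, hpq.inv_add_inv_eq_one,
      ENNReal.rpow_one]
  have hSp0 : S ^ (1 / p) ≠ 0 := (ENNReal.rpow_pos (pos_iff_ne_zero.2 hS0) hSt).ne'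
  have hSpt : S ^ (1 / p) ≠ ∞ := ENNReal.rpow_ne_top_of_nonneg (by positivity) hSt
  refine (ENNReal.mul_le_mul_iff_left hSp0 hSpt).1 ?_
  rw [← hsplit]
  refine h'.trans (le_of_eq ?_)
  ring

theorem hardyCondition_of_dualityCondition {p : ℝ} (hp : 1 < p) {u : ℝ → ℝ}
    (hu : LocallyIntegrable u volume) (hu_pos : ∀ᵐ x ∂volume, 0 < u x) {w : ℝ → ℝ}
    (hw : LocallyIntegrableOn w (Ioi 0) volume) (h : DualityCondition p u w) :
    HardyCondition p u w := by
  obtain ⟨C, hC, h⟩ := h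
  have hp0 : 0 < p := zero_lt_one.trans hp
  have hpq : p.HolderConjugate (p / (p - 1)) := Real.HolderConjugate.conjExponent hp
  have hq0 : 0 < p / (p - 1) := hpq.symm.pos
  simp only [HardyCondition, hardy_integral_eq hw]
  set q := p / (p - 1) with hq
  set G := (geomConst (1 / (2 * p)) ^ p * geomConst (1 / 2)) ^ (1 / p) with hG
  have hGt : G ≠ ∞ := ENNReal.rpow_ne_top_of_nonneg (by positivity) (ENNReal.mul_ne_top
    (ENNReal.rpow_ne_top_of_nonneg hp0.le (geomConst_ne_top (by positivity)))
    (geomConst_ne_top (by positivity)))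
  refine ⟨2 * G.toNNReal * C + 1, by positivity, fun I hI => ?_⟩
  push_cast
  rw [ENNReal.coe_toNNReal hGt, wMeas_eq]
  set W₁ := primitive w (weight u I) with hW₁
  rcases eq_or_ne W₁ 0 with h0 | h0
  · rw [h0, ENNReal.zero_rpow_of_pos (by positivity), ENNReal.div_zero hI.volume_pos.ne',
      ENNReal.mul_top (by simp)]
    exact le_top
  -- Then `W = ∞` on all of `(0, ∞)` and the integrand `φ_I/W` vanishes.
  rcases eq_or_ne W₁ ∞ with ht | ht
  · have : ∫⁻ t in initialSegment (weight u I), hardyRatio u w I t ^ q ∂halfWeight w = 0 := by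
      rw [setLIntegral_congr_fun (g := fun _ => 0) (measurableSet_initialSegment _)]
      · simp
      · intro t hts
        have := primitive_eq_top hw (weight_ne_top hu hI.2.1) ht
          (s := ENNReal.ofReal t) (by simpa using hts.1)
        simp [hardyRatio, this, hq0]
    rw [this, ENNReal.zero_rpow_of_pos (by positivity)]
    exact zero_le
  have hV0 : W₁ ^ (1 / p) ≠ 0 := (ENNReal.rpow_pos (pos_iff_ne_zero.2 h0) ht).ne'
  have hVt : W₁ ^ (1 / p) ≠ ∞ := ENNReal.rpow_ne_top_of_nonneg (by positivity) ht
  have hd := h I hI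
  rw [lorentzNorm_indicator hp0 u hw, wMeas_eq, ← hW₁,
    ← ENNReal.le_div_iff_mul_le (Or.inl hV0) (Or.inl hVt)] at hd
  have hAt : associateNorm p u w (I.indicator fun x => (u x)⁻¹) ≠ ∞ :=
    ne_top_of_le_ne_top (ENNReal.div_ne_top
      (ENNReal.mul_ne_top ENNReal.coe_ne_top hI.volume_ne_top) hV0) hd
  have hpos : ∀ a, 0 < a → ENNReal.ofReal a ≤ weight u I → primitive w (ENNReal.ofReal a) ≠ 0 :=
    fun a ha haI => primitive_ne_zero_of_associateNorm hp0 hu hu_pos hw hI hAt ha haI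
  have hIt : ENNReal.ofReal (weight u I).toReal = weight u I :=
    ENNReal.ofReal_toReal (weight_ne_top hu hI.2.1)
  have hI0 : weight u I ≠ 0 := fun hz =>
    hI.volume_pos.ne' (absolutelyContinuous_weight hu hu_pos hz)
  obtain ⟨t, ht0, hanti, htT, htW⟩ := exists_primitive_eq_geometric (w := w)
    (ENNReal.toReal_pos hI0 (weight_ne_top hu hI.2.1)) (by rwa [hIt])
    (fun a ha haT => hpos a ha (hIt ▸ ENNReal.ofReal_le_ofReal haT))
  rw [hIt, ← hW₁] at htW
  have htI : ∀ k, ENNReal.ofReal (t k) ≤ weight u I := fun k =>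
    hIt ▸ ENNReal.ofReal_le_ofReal (htT k).2
  set A := associateNorm p u w (I.indicator fun x => (u x)⁻¹) with hA
  have hsum : ∑' k, (phi u I (t k) / (W₁ * (2⁻¹) ^ k)) ^ q * (W₁ * (2⁻¹) ^ k) ≤ (G * A) ^ q := by
    refine ENNReal.tsum_le_of_sum_range_le fun N => ?_
    have := sum_phi_le_associateNorm hpq hu hu_pos hw hI h0 ht hanti (fun k => (htT k).1) htI htW N
    rwa [one_div, ENNReal.rpow_inv_le_iff hq0] at this
  have hint := hardyRatio_integral_le_tsum hu hu_pos hI hq0 ht (by rw [ht0, hIt]) hanti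
    (fun k => (htT k).1) htW hpos
  calc _ ≤ ((2 * (G * A)) ^ q) ^ (1 / q) := by
        refine ENNReal.rpow_le_rpow (hint.trans ?_) (by positivity)
        rw [ENNReal.mul_rpow_of_nonneg _ _ hq0.le]
        gcongr
    _ = 2 * (G * A) := by rw [one_div, ENNReal.rpow_rpow_inv hq0.ne']
    _ ≤ 2 * (G * (C * volume I / W₁ ^ (1 / p))) := by gcongr
    _ = 2 * G * C * (volume I / W₁ ^ (1 / p)) := by
        simp only [div_eq_mul_inv]
        ring
    _ ≤ _ := by
        gcongr
        exact le_self_add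

end WeightedLorentz

theorem proposition2 (p : ℝ) (hp : 0 < p) (u w : ℝ → ℝ)
    (hu : LocallyIntegrable u volume) (hu_pos : ∀ᵐ x ∂volume, 0 < u x)
    (hw : LocallyIntegrableOn w (Ioi 0) volume)
    (hw_nonneg : ∀ᵐ t ∂(volume.restrict (Ioi (0 : ℝ))), 0 ≤ w t) :
    (p ≤ 1 →
      (WeightedLorentz.DualityCondition p u w ↔ WeightedLorentz.QuasiconcaveCondition p u w)) ∧
    (1 < p →
      (WeightedLorentz.DualityCondition p u w ↔ WeightedLorentz.HardyCondition p u w)) := by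
  exact ⟨fun hp1 => ⟨WeightedLorentz.quasiconcaveCondition_of_dualityCondition hp hw hu_pos,
      WeightedLorentz.dualityCondition_of_quasiconcaveCondition hp hp1 hw hu_pos⟩,
    fun hp1 => ⟨WeightedLorentz.hardyCondition_of_dualityCondition hp1 hu hu_pos hw,
      WeightedLorentz.dualityCondition_of_hardyCondition hp1 hu hu_pos hw⟩⟩

end
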